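/- Let $K$ be a field. Let $E$ be the free $K[S_2]$-module with basis $\{m,\searrow\}$, let $\mathcal P(E)$ be the free symmetric operad of $K$-vector spaces generated by $E$ in arity two, and let $\mathcal P_\searrow=\mathcal P(E)/(R)$, where $R\subseteq\mathcal P(E)(3)$ is the sub-$S_3$-module generated by the relations $$\searrow\circ(m,I)=\searrow\circ(I,\searrow),\qquad \searrow\circ(I,m)=m\circ(\searrow,I),\qquad m\circ(m,I)=m\circ(I,m).$$ Let $\mathcal P_\searrow^!=\mathcal P(E^\vee)/(R^\perp)$ be its Koszul dual. Here $E^\vee=E^*\otimes\mathrm{sgn}$ is identified with the free $K[S_2]$-module on the elements dual to $m,\searrow$ (again denoted $m,\searrow$), and $R^\perp\subseteq\mathcal P(E^\vee)(3)$ is the orthogonal of $R$ for the pairing in which distinct labelled planar binary trees are orthogonal and $\langle t,t\rangle=\operatorname{sgn}(\sigma)$ if $t=(\omega\circ(\omega',I))$ with leaves labelled $\sigma(1),\sigma(2),\sigma(3)$ from left to right, $\langle t,t\rangle=-\operatorname{sgn}(\sigma)$ if $t=(\omega\circ(I,\omega'))$ with leaves so labelled ($\omega,\omega'\in\{m,\searrow\}$,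 $\sigma\in S_3$). 1. For every $n\ge 1$, $\dim_K\mathcal P_\searrow^!(n)=n\cdot n!$. 2. For every $n\ge1$, $\mathcal P_\searrow^!(n)$ is a free $K[S_n]$-module with basis the $n$ right combs $$t_i=1\searrow\bigl(2\searrow(\cdots\searrow((i-1)\searrow(i\,m\,((i+1)\,m\,(\cdots m\,n))))\cdots)\bigr),\qquad 1\le i\le n,$$ whose leaves are labelled $1,\dots,n$ from left to right and whose internal vertices, from the root upwards, are $i-1$ times $\searrow$ and then $n-i$ times $m$. 3. Let $V$ be a $K$-vector space, and let $T_\searrow(V)=\bigoplus_{n\ge1}\bigoplus_{k=1}^nV^{\otimes n}$. Write $v_1\otimes\cdots\otimes\dot v_k\otimes\cdots\otimes v_n$ for the elements of the $k$-th copy of $V^{\otimes n}$. Define bilinear products on $T_\searrow(V)$ as follows. For $v=v_1\otimes\cdots\otimes\dot v_k\otimes\cdots\otimes v_p$ and $w=w_1\otimes\cdots\otimes\dot w_l\otimes\cdots\otimes w_q$, $$m(v,w)=\begin{cases}v_1\otimes\cdots\otimes\dot v_k\otimes\cdots\otimes v_p\otimes w_1\otimes\cdots\otimes w_q&\text{if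 }l=1,\\0&\text{if }l\ne1,\end{cases}$$ $$v\searrow w=\begin{cases}v_1\otimes\cdots\otimes v_p\otimes w_1\otimes\cdots\otimes\dot w_l\otimes\cdots\otimes w_q&\text{if }k=1,\\0&\text{if }k\ne1.\end{cases}$$ Then $T_\searrow(V)$ carries a structure of $\mathcal P_\searrow^!$-algebra in which $m$ and $\searrow$ act by these products, and with $V\to T_\searrow(V)$, $v\mapsto\dot v$, it is the free $\mathcal P_\searrow^!$-algebra on $V$. -/

import Mathlib

open scoped TensorProduct DirectSum

universe u v w

noncomputable section

/-! ## Symmetric operads, ideals, quotients, algebras -/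

/-- A symmetric operad of `K`-vector spaces, in its coordinate-free form: a functor `X ↦ obj X` from
finite sets and bijections to vector spaces (so `obj (Fin n)` is the arity `n` component, and
`Equiv.Perm (Fin n)` acts on it through `map`), with a unit and total compositions
`p ∘ (g_x)_{x ∈ X}` that are multilinear, natural, unital and associative. -/
structure SymmOperad (K : Type u) [Field K] where
  obj : (X : Type) → [Finite X] → Type u
  [acg : ∀ (X : Type) [Finite X], AddCommGroup (obj X)]
  [mod : ∀ (X : Type) [Finite X], Module K (obj X)]
  map : ∀ {X Y : Type} [Finite X] [Finite Y], (X ≃ Y) → obj X →ₗ[K] obj Y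
  one : obj Unit
  comp : ∀ {X : Type} [Finite X] {Y : X → Type} [∀ x, Finite (Y x)],
    obj X →ₗ[K] MultilinearMap K (fun x => obj (Y x)) (obj (Σ x, Y x))
  map_refl : ∀ {X : Type} [Finite X] (p : obj X), map (Equiv.refl X) p = p
  map_trans : ∀ {X Y Z : Type} [Finite X] [Finite Y] [Finite Z] (e : X ≃ Y) (f : Y ≃ Z)
    (p : obj X), map (e.trans f) p = map f (map e p)
  comp_map_right : ∀ {X : Type} [Finite X] {Y Y' : X → Type} [∀ x, Finite (Y x)]
    [∀ x, Finite (Y' x)] (e : ∀ x, Y x ≃ Y' x) (p : obj X) (g : ∀ x, obj (Y x)),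
    comp p (fun x => map (e x) (g x)) = map (Equiv.sigmaCongrRight e) (comp p g)
  comp_map_left : ∀ {X X' : Type} [Finite X] [Finite X'] {Y : X' → Type} [∀ x, Finite (Y x)]
    (e : X ≃ X') (p : obj X) (g : ∀ x, obj (Y x)),
    comp (map e p) g = map (Equiv.sigmaCongrLeft e) (comp p (fun x => g (e x)))
  one_comp : ∀ {X : Type} [Finite X] (p : obj X),
    map (Equiv.uniqueSigma (fun _ : Unit => X)) (comp one (fun _ => p)) = p
  comp_one : ∀ {X : Type} [Finite X] (p : obj X),
    map (Equiv.sigmaUnique X (fun _ => Unit)) (comp p (fun _ => one)) = p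
  comp_assoc : ∀ {X : Type} [Finite X] {Y : X → Type} [∀ x, Finite (Y x)]
    {Z : ∀ x, Y x → Type} [∀ x y, Finite (Z x y)]
    (p : obj X) (g : ∀ x, obj (Y x)) (h : ∀ x y, obj (Z x y)),
    map (Equiv.sigmaAssoc Z) (comp (comp p g) (fun z => h z.1 z.2)) =
      comp p (fun x => comp (g x) (fun y => h x y))

namespace SymmOperad

attribute [instance] SymmOperad.acg SymmOperad.mod

variable {K : Type u} [Field K]

/-- The action of the symmetric group on the arity `n` component of an operad. -/
def rep (P : SymmOperad K) (n : ℕ) :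
    Representation K (Equiv.Perm (Fin n)) (P.obj (Fin n)) where
  toFun σ := P.map σ
  map_one' := by
    ext p
    exact P.map_refl p
  map_mul' σ τ := by
    ext p
    exact P.map_trans τ σ p

/-- A (two-sided) operadic ideal. -/
structure OpIdeal (P : SymmOperad K) where
  carrier : (X : Type) → [Finite X] → Submodule K (P.obj X)
  map_mem : ∀ {X Y : Type} [Finite X] [Finite Y] (e : X ≃ Y) (p : P.obj X),
    p ∈ carrier X → P.map e p ∈ carrier Y
  comp_mem_left : ∀ {X : Type} [Finite X] {Y : X → Type} [∀ x, Finite (Y x)] (p : P.obj X)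
    (g : ∀ x, P.obj (Y x)), p ∈ carrier X → P.comp p g ∈ carrier (Σ x, Y x)
  comp_mem_right : ∀ {X : Type} [Finite X] {Y : X → Type} [∀ x, Finite (Y x)] (p : P.obj X)
    (g : ∀ x, P.obj (Y x)) (x : X), g x ∈ carrier (Y x) → P.comp p g ∈ carrier (Σ x, Y x)

/-- The smallest operadic ideal that contains a given set of elements of arity `n`. -/
def OpIdeal.span (P : SymmOperad K) {n : ℕ} (S : Set (P.obj (Fin n))) : P.OpIdeal where
  carrier X := ⨅ I : { I : P.OpIdeal // S ⊆ I.carrier (Fin n) }, I.1.carrier X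
  map_mem e p hp := by
    simp only [Submodule.mem_iInf] at hp ⊢
    exact fun I => I.1.map_mem e p (hp I)
  comp_mem_left p g hp := by
    simp only [Submodule.mem_iInf] at hp ⊢
    exact fun I => I.1.comp_mem_left p g (hp I)
  comp_mem_right p g x hx := by
    simp only [Submodule.mem_iInf] at hx ⊢
    exact fun I => I.1.comp_mem_right p g x (hx I)

section Quotient

variable {P : SymmOperad K} (I : P.OpIdeal)

theorem OpIdeal.comp_congr {X : Type} [Finite X] {Y : X → Type} [∀ x, Finite (Y x)]
    (p : P.obj X) (g g' : ∀ x, P.obj (Y x)) (h : ∀ x, g x - g' x ∈ I.carrier (Y x)) :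
    P.comp p g - P.comp p g' ∈ I.carrier (Σ x, Y x) := by
  classical
  have := Fintype.ofFinite X
  have key : ∀ s : Finset X, P.comp p (s.piecewise g g') - P.comp p g' ∈ I.carrier _ := by
    intro s
    induction s using Finset.induction_on with
    | empty => simp
    | insert a s ha ih =>
      have e1 : P.comp p ((insert a s).piecewise g g') - P.comp p (s.piecewise g g') =
          P.comp p (Function.update (s.piecewise g g') a (g a - g' a)) := by
        rw [MultilinearMap.map_update_sub, Finset.piecewise_insert]
        congr 2
        rw [Function.eq_update_iff]
        simp [ha]
      have e2 : P.comp p (Function.update (s.piecewise g g') a (g a - g' a)) ∈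
          I.carrier (Σ x, Y x) := by
        apply I.comp_mem_right p _ a
        simpa using h a
      have := add_mem (e1 ▸ e2) ih
      simpa using this
  simpa using key Finset.univ

/-- The composition of representatives, as a multilinear map on the quotients. -/
def OpIdeal.compAux {X : Type} [Finite X] {Y : X → Type} [∀ x, Finite (Y x)] (p : P.obj X) :
    MultilinearMap K (fun x => P.obj (Y x) ⧸ I.carrier (Y x))
      (P.obj (Σ x, Y x) ⧸ I.carrier (Σ x, Y x)) where
  toFun g := (I.carrier (Σ x, Y x)).mkQ (P.comp p (fun x => (g x).out))
  map_update_add' g x a b := by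
    rw [← map_add, ← sub_eq_zero, ← map_sub]
    have h1 : ∀ c, (fun y => (Function.update g x c y).out) =
        Function.update (fun y => (g y).out) x c.out := fun c =>
      funext fun y => Function.apply_update (fun _ z => Quotient.out z) g x c y
    rw [h1, h1, h1, ← MultilinearMap.map_update_add, Submodule.mkQ_apply,
      Submodule.Quotient.mk_eq_zero]
    refine I.comp_congr p _ _ fun y => ?_
    by_cases hy : y = x
    · subst hy
      simp [← Submodule.Quotient.eq, Submodule.Quotient.mk_out]
    · simp [hy]
  map_update_smul' g x c a := by
    rw [← map_smul, ← sub_eq_zero, ← map_sub]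
    have h1 : ∀ c, (fun y => (Function.update g x c y).out) =
        Function.update (fun y => (g y).out) x c.out := fun c =>
      funext fun y => Function.apply_update (fun _ z => Quotient.out z) g x c y
    rw [h1, h1, ← MultilinearMap.map_update_smul, Submodule.mkQ_apply,
      Submodule.Quotient.mk_eq_zero]
    refine I.comp_congr p _ _ fun y => ?_
    by_cases hy : y = x
    · subst hy
      simp [← Submodule.Quotient.eq, Submodule.Quotient.mk_out]
    · simp [hy]

/-- The composition of the quotient operad. -/
def OpIdeal.quotComp {X : Type} [Finite X] {Y : X → Type} [∀ x, Finite (Y x)] :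
    (P.obj X ⧸ I.carrier X) →ₗ[K] MultilinearMap K (fun x => P.obj (Y x) ⧸ I.carrier (Y x))
      (P.obj (Σ x, Y x) ⧸ I.carrier (Σ x, Y x)) :=
  (I.carrier X).liftQ
    { toFun := I.compAux
      map_add' := fun p q => by
        ext g
        simp [OpIdeal.compAux]
      map_smul' := fun c p => by
        ext g
        simp [OpIdeal.compAux] }
    (by
      intro p hp
      rw [LinearMap.mem_ker]
      ext g
      simpa [OpIdeal.compAux] using I.comp_mem_left p _ hp)

theorem OpIdeal.quotComp_mk {X : Type} [Finite X] {Y : X → Type} [∀ x, Finite (Y x)]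
    (p : P.obj X) (g : ∀ x, P.obj (Y x)) :
    I.quotComp (Submodule.Quotient.mk p) (fun x => Submodule.Quotient.mk (g x)) =
      Submodule.Quotient.mk (P.comp p g) := by
  change Submodule.Quotient.mk (P.comp p _) = _
  rw [Submodule.Quotient.eq]
  refine I.comp_congr p _ _ fun x => ?_
  simp [← Submodule.Quotient.eq, Submodule.Quotient.mk_out]

/-- The structure map of the quotient operad. -/
def OpIdeal.quotMap {X Y : Type} [Finite X] [Finite Y] (e : X ≃ Y) :
    (P.obj X ⧸ I.carrier X) →ₗ[K] (P.obj Y ⧸ I.carrier Y) :=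
  (I.carrier X).mapQ (I.carrier Y) (P.map e) (fun p hp => I.map_mem e p hp)

theorem OpIdeal.quotMap_mk {X Y : Type} [Finite X] [Finite Y] (e : X ≃ Y) (p : P.obj X) :
    I.quotMap e (Submodule.Quotient.mk p) = Submodule.Quotient.mk (P.map e p) := rfl

theorem OpIdeal.exists_rep {X : Type} {Y : X → Type} [∀ x, Finite (Y x)]
    (g : ∀ x, P.obj (Y x) ⧸ I.carrier (Y x)) :
    ∃ g' : ∀ x, P.obj (Y x), g = fun x => Submodule.Quotient.mk (g' x) :=
  ⟨fun x => (g x).out, funext fun x => (Submodule.Quotient.mk_out (g x)).symm⟩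

/-- The quotient of an operad by an operadic ideal. -/
def quot (P : SymmOperad K) (I : P.OpIdeal) : SymmOperad K where
  obj X := P.obj X ⧸ I.carrier X
  map e := I.quotMap e
  one := Submodule.Quotient.mk P.one
  comp := I.quotComp
  map_refl p := by
    obtain ⟨p, rfl⟩ := Submodule.Quotient.mk_surjective _ p
    rw [I.quotMap_mk, P.map_refl]
  map_trans e f p := by
    obtain ⟨p, rfl⟩ := Submodule.Quotient.mk_surjective _ p
    simp only [I.quotMap_mk, P.map_trans]
  comp_map_right e p g := by
    obtain ⟨p, rfl⟩ := Submodule.Quotient.mk_surjective _ p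
    obtain ⟨g, rfl⟩ := I.exists_rep g
    simp only [I.quotMap_mk, I.quotComp_mk, P.comp_map_right]
  comp_map_left e p g := by
    obtain ⟨p, rfl⟩ := Submodule.Quotient.mk_surjective _ p
    obtain ⟨g, rfl⟩ := I.exists_rep g
    simp only [I.quotMap_mk, I.quotComp_mk, P.comp_map_left]
  one_comp p := by
    obtain ⟨p, rfl⟩ := Submodule.Quotient.mk_surjective _ p
    simp only [I.quotMap_mk, I.quotComp_mk, P.one_comp]
  comp_one p := by
    obtain ⟨p, rfl⟩ := Submodule.Quotient.mk_surjective _ p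
    simp only [I.quotMap_mk, I.quotComp_mk, P.comp_one]
  comp_assoc {X} _ {Y} _ {Z} _ p g h := by
    obtain ⟨p, rfl⟩ := Submodule.Quotient.mk_surjective _ p
    obtain ⟨g, rfl⟩ := I.exists_rep g
    obtain ⟨h', hh⟩ := I.exists_rep (fun z : Σ x, Y x => h z.1 z.2)
    have hh2 : h = fun x y => Submodule.Quotient.mk (h' ⟨x, y⟩) :=
      funext fun x => funext fun y => congrFun hh ⟨x, y⟩
    subst hh2
    simp only [I.quotMap_mk, I.quotComp_mk]
    exact congrArg _ (P.comp_assoc p g (fun x y => h' ⟨x, y⟩))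

end Quotient

/-- A structure of algebra over the operad `P` on the vector space `A`: a morphism of operads from
`P` to the endomorphism operad of `A`. -/
structure AlgStr (P : SymmOperad K) (A : Type v) [AddCommGroup A] [Module K A] where
  act : ∀ {X : Type} [Finite X], P.obj X →ₗ[K] MultilinearMap K (fun _ : X => A) A
  act_map : ∀ {X Y : Type} [Finite X] [Finite Y] (e : X ≃ Y) (p : P.obj X) (a : Y → A),
    act (P.map e p) a = act p (fun x => a (e x))
  act_one : ∀ a : Unit → A, act P.one a = a ()
  act_comp : ∀ {X : Type} [Finite X] {Y : X → Type} [∀ x, Finite (Y x)] (p : P.obj X)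
    (g : ∀ x, P.obj (Y x)) (a : (Σ x, Y x) → A),
    act (P.comp p g) a = act p (fun x => act (g x) (fun y => a ⟨x, y⟩))

/-- Morphisms of algebras over an operad. -/
def AlgStr.IsHom {P : SymmOperad K} {A : Type v} [AddCommGroup A] [Module K A]
    {B : Type w} [AddCommGroup B] [Module K B] (𝔞 : P.AlgStr A) (𝔟 : P.AlgStr B)
    (f : A →ₗ[K] B) : Prop :=
  ∀ {X : Type} [Finite X] (p : P.obj X) (a : X → A), f (𝔞.act p a) = 𝔟.act p (fun x => f (a x))

/-- `A`, with the linear map `ι : V → A`, is the free `P`-algebra on the vector space `V`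
(universal property against all `P`-algebras in `Type w`). -/
def AlgStr.IsFreeOn {P : SymmOperad K} {A : Type*} [AddCommGroup A] [Module K A]
    (𝔞 : P.AlgStr A) {V : Type*} [AddCommGroup V] [Module K V] (ι : V →ₗ[K] A) : Prop :=
  ∀ (B : Type w) [AddCommGroup B] [Module K B] (𝔟 : P.AlgStr B) (φ : V →ₗ[K] B),
    ∃! f : A →ₗ[K] B, 𝔞.IsHom 𝔟 f ∧ f ∘ₗ ι = φ

end SymmOperad

/-! ## The free operad on a free `S₂`-module of binary generators -/

/-- Planar binary trees with internal vertices decorated by `Ω` and leaves decorated by `X`. -/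
inductive OpTree (Ω X : Type) : Type
  | leaf : X → OpTree Ω X
  | node : Ω → OpTree Ω X → OpTree Ω X → OpTree Ω X

namespace OpTree

variable {Ω X Y Z : Type}

/-- The decorations of the leaves, read from left to right. -/
def leaves : OpTree Ω X → List X
  | leaf x => [x]
  | node _ s t => s.leaves ++ t.leaves

/-- Change of the decorations of the leaves. -/
def map (f : X → Y) : OpTree Ω X → OpTree Ω Y
  | leaf x => leaf (f x)
  | node ω s t => node ω (s.map f) (t.map f)

/-- Every element of `X` decorates exactly one leaf. -/
def IsLabelled (t : OpTree Ω X) : Prop := t.leaves.Nodup ∧ ∀ x, x ∈ t.leaves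

theorem leaves_map (f : X → Y) (t : OpTree Ω X) : (t.map f).leaves = t.leaves.map f := by
  induction t with
  | leaf x => rfl
  | node ω s t hs ht => simp [map, leaves, hs, ht]

theorem IsLabelled.map_equiv {t : OpTree Ω X} (h : t.IsLabelled) (e : X ≃ Y) :
    (t.map e).IsLabelled := by
  refine ⟨?_, fun y => ?_⟩
  · rw [leaves_map]
    exact h.1.map e.injective
  · rw [leaves_map]
    exact List.mem_map.2 ⟨e.symm y, h.2 _, by simp⟩

variable {K : Type u} [Field K] {A : Type v} [AddCommGroup A] [Module K A]
  {B : Type w} [AddCommGroup B] [Module K B]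

/-- The value of a tree when its vertices are read as bilinear operations of `A` and its leaves
as elements of `A`. -/
def eval (β : Ω → A →ₗ[K] A →ₗ[K] A) (a : X → A) : OpTree Ω X → A
  | leaf x => a x
  | node ω s t => β ω (s.eval β a) (t.eval β a)

theorem eval_congr (β : Ω → A →ₗ[K] A →ₗ[K] A) {a b : X → A} {t : OpTree Ω X}
    (h : ∀ x ∈ t.leaves, a x = b x) : t.eval β a = t.eval β b := by
  induction t with
  | leaf x => exact h x (by simp [leaves])
  | node ω s t hs ht =>
    simp only [eval]
    rw [hs fun x hx => h x (by simp [leaves, hx]), ht fun x hx => h x (by simp [leaves, hx])]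

theorem eval_update_of_not_mem [DecidableEq X] (β : Ω → A →ₗ[K] A →ₗ[K] A) (a : X → A)
    {t : OpTree Ω X} {x : X} (h : x ∉ t.leaves) (u : A) :
    t.eval β (Function.update a x u) = t.eval β a :=
  eval_congr β fun y hy => Function.update_of_ne (fun e : y = x => h (e ▸ hy)) _ _

theorem eval_update_add [DecidableEq X] (β : Ω → A →ₗ[K] A →ₗ[K] A) (a : X → A)
    {t : OpTree Ω X} (hn : t.leaves.Nodup) {x : X} (hx : x ∈ t.leaves) (u v : A) :
    t.eval β (Function.update a x (u + v)) =
      t.eval β (Function.update a x u) + t.eval β (Function.update a x v) := by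
  induction t with
  | leaf y =>
    obtain rfl : x = y := by simpa [leaves] using hx
    simp [eval]
  | node ω s t hs ht =>
    simp only [leaves, List.nodup_append', List.mem_append] at hn hx
    rcases hx with hx | hx
    · have h' : x ∉ t.leaves := fun h' => hn.2.2 hx h'
      simp only [eval, eval_update_of_not_mem β a h', hs hn.1 hx, map_add, LinearMap.add_apply]
    · have h' : x ∉ s.leaves := fun h' => hn.2.2 h' hx
      simp only [eval, eval_update_of_not_mem β a h', ht hn.2.1 hx, map_add]

theorem eval_update_smul [DecidableEq X] (β : Ω → A →ₗ[K] A →ₗ[K] A) (a : X → A)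
    {t : OpTree Ω X} (hn : t.leaves.Nodup) {x : X} (hx : x ∈ t.leaves) (c : K) (u : A) :
    t.eval β (Function.update a x (c • u)) = c • t.eval β (Function.update a x u) := by
  induction t with
  | leaf y =>
    obtain rfl : x = y := by simpa [leaves] using hx
    simp [eval]
  | node ω s t hs ht =>
    simp only [leaves, List.nodup_append', List.mem_append] at hn hx
    rcases hx with hx | hx
    · have h' : x ∉ t.leaves := fun h' => hn.2.2 hx h'
      simp only [eval, eval_update_of_not_mem β a h', hs hn.1 hx, map_smul, LinearMap.smul_apply]
    · have h' : x ∉ s.leaves := fun h' => hn.2.2 h' hx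
      simp only [eval, eval_update_of_not_mem β a h', ht hn.2.1 hx, map_smul]

/-- The linear extension of `OpTree.eval` to linear combinations of trees. -/
def evalLin (β : Ω → A →ₗ[K] A →ₗ[K] A) (a : X → A) : (OpTree Ω X →₀ K) →ₗ[K] A :=
  Finsupp.linearCombination K (eval β a)

theorem evalLin_single (β : Ω → A →ₗ[K] A →ₗ[K] A) (a : X → A) (t : OpTree Ω X) (c : K) :
    evalLin β a (Finsupp.single t c) = c • t.eval β a := by
  simp [evalLin]

variable (K) in
/-- The operation `ω` on linear combinations of trees. -/
def opLin (ω : Ω) : (OpTree Ω X →₀ K) →ₗ[K] (OpTree Ω X →₀ K) →ₗ[K] (OpTree Ω X →₀ K) :=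
  Finsupp.linearCombination K (fun s => Finsupp.lmapDomain K K (node ω s))

theorem opLin_single (ω : Ω) (s t : OpTree Ω X) (c d : K) :
    opLin K ω (Finsupp.single s c) (Finsupp.single t d) = Finsupp.single (node ω s t) (c * d) := by
  simp [opLin]

variable (K) in
/-- Change of the decorations of the leaves, on linear combinations of trees. -/
def mapLin (f : X → Y) : (OpTree Ω X →₀ K) →ₗ[K] (OpTree Ω Y →₀ K) :=
  Finsupp.lmapDomain K K (map f)

theorem mapLin_single (f : X → Y) (t : OpTree Ω X) (c : K) :
    mapLin K f (Finsupp.single t c) = Finsupp.single (t.map f) c := by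
  simp [mapLin]

theorem hom_evalLin (β : Ω → A →ₗ[K] A →ₗ[K] A) (β' : Ω → B →ₗ[K] B →ₗ[K] B) (φ : A →ₗ[K] B)
    (hφ : ∀ ω a b, φ (β ω a b) = β' ω (φ a) (φ b)) (a : X → A) (p : OpTree Ω X →₀ K) :
    φ (evalLin β a p) = evalLin β' (fun x => φ (a x)) p := by
  have h : ∀ t : OpTree Ω X, φ (t.eval β a) = t.eval β' (fun x => φ (a x)) := by
    intro t
    induction t with
    | leaf x => rfl
    | node ω s t hs ht => simp only [eval, hφ, hs, ht]
  induction p using Finsupp.induction_linear with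
  | zero => simp
  | add p q hp hq => simp [hp, hq]
  | single t c => simp [evalLin_single, h]

theorem evalLin_opLin (β : Ω → A →ₗ[K] A →ₗ[K] A) (a : X → A) (ω : Ω) (p q : OpTree Ω X →₀ K) :
    evalLin β a (opLin K ω p q) = β ω (evalLin β a p) (evalLin β a q) := by
  induction p using Finsupp.induction_linear with
  | zero => simp
  | add p p' hp hp' => simp [hp, hp']
  | single s c =>
    induction q using Finsupp.induction_linear with
    | zero => simp
    | add p p' hp hp' => simp [hp, hp']
    | single t d =>
      simp only [opLin_single, evalLin_single, eval, mul_smul, map_smul, LinearMap.smul_apply]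
      rw [smul_comm]

theorem evalLin_mapLin (β : Ω → A →ₗ[K] A →ₗ[K] A) (f : X → Y) (a : Y → A)
    (p : OpTree Ω X →₀ K) :
    evalLin β a (mapLin K f p) = evalLin β (fun x => a (f x)) p := by
  have h : ∀ t : OpTree Ω X, (t.map f).eval β a = t.eval β (fun x => a (f x)) := by
    intro t
    induction t with
    | leaf x => rfl
    | node ω s t hs ht => simp only [map, eval, hs, ht]
  induction p using Finsupp.induction_linear with
  | zero => simp
  | add p q hp hq => simp [hp, hq]
  | single t c => simp [mapLin_single, evalLin_single, h]

theorem mapLin_opLin (f : X → Y) (ω : Ω) (p q : OpTree Ω X →₀ K) :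
    mapLin K f (opLin K ω p q) = opLin K ω (mapLin K f p) (mapLin K f q) := by
  induction p using Finsupp.induction_linear with
  | zero => simp
  | add p p' hp hp' => simp [hp, hp']
  | single s c =>
    induction q using Finsupp.induction_linear with
    | zero => simp
    | add p p' hp hp' => simp [hp, hp']
    | single t d => simp only [opLin_single, mapLin_single, map]

theorem mapLin_mapLin (f : X → Y) (g : Y → Z) (p : OpTree Ω X →₀ K) :
    mapLin K g (mapLin K f p) = mapLin K (fun x => g (f x)) p := by
  have h : ∀ t : OpTree Ω X, (t.map f).map g = t.map (fun x => g (f x)) := by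
    intro t
    induction t with
    | leaf x => rfl
    | node ω s t hs ht => simp only [map, hs, ht]
  induction p using Finsupp.induction_linear with
  | zero => simp
  | add p q hp hq => simp [hp, hq]
  | single t c => simp [mapLin_single, h]

theorem mapLin_id (p : OpTree Ω X →₀ K) : mapLin K (fun x => x) p = p := by
  have h : ∀ t : OpTree Ω X, t.map (fun x => x) = t := by
    intro t
    induction t with
    | leaf x => rfl
    | node ω s t hs ht => simp only [map, hs, ht]
  induction p using Finsupp.induction_linear with
  | zero => simp
  | add p q hp hq => simp [hp, hq]
  | single t c => simp [mapLin_single, h]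

theorem evalLin_leaf (f : X → Y) (p : OpTree Ω X →₀ K) :
    evalLin (opLin K) (fun x => Finsupp.single (leaf (f x)) 1) p = mapLin K f p := by
  have h : ∀ t : OpTree Ω X,
      t.eval (opLin K) (fun x => Finsupp.single (leaf (f x)) 1) = Finsupp.single (t.map f) 1 := by
    intro t
    induction t with
    | leaf x => rfl
    | node ω s t hs ht => simp only [eval, map, hs, ht, opLin_single, mul_one]
  induction p using Finsupp.induction_linear with
  | zero => simp
  | add p q hp hq => simp [hp, hq]
  | single t c => simp [mapLin_single, evalLin_single, h]

/-- Linear composition: the leaf `x` of the outer tree is replaced by `g x`. -/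
def compLin {Y : X → Type} (p : OpTree Ω X →₀ K) (g : ∀ x, OpTree Ω (Y x) →₀ K) :
    OpTree Ω (Σ x, Y x) →₀ K :=
  evalLin (opLin K) (fun x => mapLin K (Sigma.mk x) (g x)) p

theorem evalLin_compLin (β : Ω → A →ₗ[K] A →ₗ[K] A) {Y : X → Type} (p : OpTree Ω X →₀ K)
    (g : ∀ x, OpTree Ω (Y x) →₀ K) (a : (Σ x, Y x) → A) :
    evalLin β a (compLin p g) = evalLin β (fun x => evalLin β (fun y => a ⟨x, y⟩) (g x)) p := by
  rw [compLin, hom_evalLin (opLin K) β (evalLin β a) (evalLin_opLin β a)]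
  simp only [evalLin_mapLin]

theorem mapLin_compLin {Y : X → Type} (p : OpTree Ω X →₀ K)
    (g : ∀ x, OpTree Ω (Y x) →₀ K) (f : (Σ x, Y x) → Z) :
    mapLin K f (compLin p g) =
      evalLin (opLin K) (fun x => mapLin K (fun y => f ⟨x, y⟩) (g x)) p := by
  rw [compLin, hom_evalLin (opLin K) (opLin K) (mapLin K f) (mapLin_opLin f)]
  simp only [mapLin_mapLin]

/-- The linear combinations of labelled trees. -/
def labelled (K : Type u) [Field K] (Ω X : Type) : Submodule K (OpTree Ω X →₀ K) := Finsupp.supported K K {t | t.IsLabelled}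

theorem mapLin_mem (e : X ≃ Y) {p : OpTree Ω X →₀ K} (hp : p ∈ labelled K Ω X) :
    mapLin K e p ∈ labelled K Ω Y := by
  classical
  intro t ht
  have := Finsupp.mapDomain_support ht
  obtain ⟨s, hs, rfl⟩ := Finset.mem_image.1 this
  exact IsLabelled.map_equiv (hp hs) e

theorem single_mem {t : OpTree Ω X} (ht : t.IsLabelled) (c : K) :
    Finsupp.single t c ∈ labelled K Ω X :=
  Finsupp.single_mem_supported K c ht

theorem opLin_mem (ω : Ω) {S T U : Set (OpTree Ω X)} (h : ∀ s ∈ S, ∀ t ∈ T, node ω s t ∈ U)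
    {p q : OpTree Ω X →₀ K} (hp : p ∈ Finsupp.supported K K S)
    (hq : q ∈ Finsupp.supported K K T) : opLin K ω p q ∈ Finsupp.supported K K U := by
  classical
  rw [opLin, Finsupp.linearCombination_apply, Finsupp.sum, LinearMap.sum_apply]
  refine Submodule.sum_mem _ fun s hs => ?_
  rw [LinearMap.smul_apply]
  refine Submodule.smul_mem _ _ fun t ht => ?_
  obtain ⟨t', ht', rfl⟩ := Finset.mem_image.1 (Finsupp.mapDomain_support ht)
  exact h s (hp hs) t' (hq ht')

theorem compLin_mem {Y : X → Type} {p : OpTree Ω X →₀ K} (hp : p ∈ labelled K Ω X)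
    {g : ∀ x, OpTree Ω (Y x) →₀ K} (hg : ∀ x, g x ∈ labelled K Ω (Y x)) :
    compLin p g ∈ labelled K Ω (Σ x, Y x) := by
  classical
  have key : ∀ t : OpTree Ω X, t.leaves.Nodup →
      t.eval (opLin K) (fun x => mapLin K (Sigma.mk x) (g x)) ∈
        Finsupp.supported K K {s : OpTree Ω (Σ x, Y x) |
          s.leaves.Nodup ∧ ∀ z, z ∈ s.leaves ↔ z.1 ∈ t.leaves} := by
    intro t
    induction t with
    | leaf x =>
      intro _ s hs
      obtain ⟨s', hs', rfl⟩ := Finset.mem_image.1 (Finsupp.mapDomain_support hs)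
      have hl := hg x hs'
      refine ⟨?_, fun z => ?_⟩
      · rw [leaves_map]
        exact hl.1.map sigma_mk_injective
      · rw [leaves_map]
        constructor
        · intro hz
          obtain ⟨y, _, rfl⟩ := List.mem_map.1 hz
          simp [leaves]
        · intro hz
          obtain ⟨x', y⟩ := z
          obtain rfl : x' = x := by simpa [leaves] using hz
          exact List.mem_map.2 ⟨y, hl.2 y, rfl⟩
    | node ω s t hs ht =>
      intro hn
      simp only [leaves, List.nodup_append'] at hn
      refine opLin_mem ω ?_ (hs hn.1) (ht hn.2.1)
      rintro s' ⟨h1, h2⟩ t' ⟨h3, h4⟩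
      refine ⟨?_, fun z => ?_⟩
      · simp only [leaves, List.nodup_append']
        refine ⟨h1, h3, fun z hz hz' => hn.2.2 ((h2 z).1 hz) ((h4 z).1 hz')⟩
      · simp [leaves, h2, h4]
  rw [compLin, evalLin, Finsupp.linearCombination_apply, Finsupp.sum]
  refine Submodule.sum_mem _ fun t ht => Submodule.smul_mem _ _ ?_
  have hl := hp ht
  refine Finsupp.supported_mono ?_ (key t hl.1)
  exact fun s hs => ⟨hs.1, fun z => (hs.2 z).2 (hl.2 z.1)⟩

theorem evalLin_update_add [DecidableEq X] (β : Ω → A →ₗ[K] A →ₗ[K] A) (a : X → A)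
    {p : OpTree Ω X →₀ K} (hp : p ∈ labelled K Ω X) (x : X) (u v : A) :
    evalLin β (Function.update a x (u + v)) p =
      evalLin β (Function.update a x u) p + evalLin β (Function.update a x v) p := by
  simp only [evalLin, Finsupp.linearCombination_apply, Finsupp.sum]
  rw [← Finset.sum_add_distrib]
  refine Finset.sum_congr rfl fun t ht => ?_
  rw [eval_update_add β a (hp ht).1 ((hp ht).2 x), smul_add]

theorem evalLin_update_smul [DecidableEq X] (β : Ω → A →ₗ[K] A →ₗ[K] A) (a : X → A)
    {p : OpTree Ω X →₀ K} (hp : p ∈ labelled K Ω X) (x : X) (c : K) (u : A) :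
    evalLin β (Function.update a x (c • u)) p = c • evalLin β (Function.update a x u) p := by
  simp only [evalLin, Finsupp.linearCombination_apply, Finsupp.sum]
  rw [Finset.smul_sum]
  refine Finset.sum_congr rfl fun t ht => ?_
  rw [eval_update_smul β a (hp ht).1 ((hp ht).2 x), smul_comm]

end OpTree

open OpTree in
/-- The free operad `𝓟(E)` on the `S₂`-module `E` that is freely generated by the set `Ω`, placed in
arity two. A basis of the arity `n` component is given by the planar binary trees with vertices
decorated by `Ω` and leaves labelled bijectively; composition is grafting on the leaves. -/
def freeBinaryOperad (K : Type u) [Field K] (Ω : Type) : SymmOperad K where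
  obj X := labelled K Ω X
  map e := (mapLin K e).restrict (fun _ hp => mapLin_mem e hp)
  one := ⟨Finsupp.single (leaf ()) 1, single_mem ⟨by simp [leaves], by simp [leaves]⟩ 1⟩
  comp {X} _ {Y} _ :=
    { toFun := fun p =>
        { toFun := fun g => ⟨compLin p.1 (fun x => (g x).1), compLin_mem p.2 (fun x => (g x).2)⟩
          map_update_add' := by
            intro _ g x a b
            apply Subtype.ext
            have h1 : ∀ c : labelled K Ω (Y x),
                (fun y => mapLin K (Sigma.mk y) (Function.update g x c y).1) =
                Function.update (fun y => mapLin K (Sigma.mk y) (g y).1) x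
                  (mapLin K (Sigma.mk x) c.1) := fun c =>
              funext fun y =>
                Function.apply_update (fun y (z : labelled K Ω (Y y)) =>
                  mapLin K (Sigma.mk y) z.1) g x c y
            simp only [compLin, h1, Submodule.coe_add, map_add]
            exact evalLin_update_add _ _ p.2 x _ _
          map_update_smul' := by
            intro _ g x c a
            apply Subtype.ext
            have h1 : ∀ c : labelled K Ω (Y x),
                (fun y => mapLin K (Sigma.mk y) (Function.update g x c y).1) =
                Function.update (fun y => mapLin K (Sigma.mk y) (g y).1) x
                  (mapLin K (Sigma.mk x) c.1) := fun c =>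
              funext fun y =>
                Function.apply_update (fun y (z : labelled K Ω (Y y)) =>
                  mapLin K (Sigma.mk y) z.1) g x c y
            simp only [compLin, h1, Submodule.coe_smul, map_smul]
            exact evalLin_update_smul _ _ p.2 x _ _ }
      map_add' := fun p q => by
        ext g : 1
        apply Subtype.ext
        simp [compLin]
      map_smul' := fun c p => by
        ext g : 1
        apply Subtype.ext
        simp [compLin] }
  map_refl p := Subtype.ext (mapLin_id p.1)
  map_trans e f p := Subtype.ext (mapLin_mapLin e f p.1).symm
  comp_map_right e p g := by
    apply Subtype.ext
    change compLin p.1 (fun x => mapLin K (e x) (g x).1) =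
      mapLin K (Equiv.sigmaCongrRight e) (compLin p.1 fun x => (g x).1)
    rw [mapLin_compLin]
    simp only [compLin, mapLin_mapLin]
    rfl
  comp_map_left e p g := by
    apply Subtype.ext
    change compLin (mapLin K e p.1) (fun x => (g x).1) =
      mapLin K (Equiv.sigmaCongrLeft e) (compLin p.1 fun x => (g (e x)).1)
    rw [mapLin_compLin, compLin, evalLin_mapLin]
    rfl
  one_comp p := by
    apply Subtype.ext
    change mapLin K (Equiv.uniqueSigma (fun _ : Unit => _))
      (compLin (Finsupp.single (leaf ()) 1) fun _ => p.1) = p.1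
    rw [mapLin_compLin, evalLin_single, one_smul]
    exact mapLin_id p.1
  comp_one {X} _ p := by
    apply Subtype.ext
    change mapLin K (Equiv.sigmaUnique X (fun _ => Unit))
      (compLin p.1 fun _ => Finsupp.single (leaf ()) 1) = p.1
    rw [mapLin_compLin]
    simp only [mapLin_single, OpTree.map]
    exact (evalLin_leaf _ p.1).trans (mapLin_id p.1)
  comp_assoc {X} _ {Y} _ {Z} _ p g h := by
    apply Subtype.ext
    change mapLin K (Equiv.sigmaAssoc Z) (compLin (compLin p.1 fun x => (g x).1)
      fun z => (h z.1 z.2).1) = compLin p.1 fun x => compLin (g x).1 fun y => (h x y).1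
    rw [mapLin_compLin, evalLin_compLin]
    conv_rhs => rw [compLin]
    simp only [mapLin_compLin]
    rfl

/-- A labelled tree, as an element of the free operad. -/
def treeElt (K : Type u) [Field K] {Ω : Type} {X : Type} [Finite X] (t : OpTree Ω X)
    (ht : t.IsLabelled) : (freeBinaryOperad K Ω).obj X :=
  (⟨Finsupp.single t 1, OpTree.single_mem ht 1⟩ : OpTree.labelled K Ω X)

/-- The coefficients of an element of the free operad in the basis of labelled trees. -/
def treeCoeff {K : Type u} [Field K] {Ω : Type} {X : Type} [Finite X] :
    (freeBinaryOperad K Ω).obj X →ₗ[K] (OpTree Ω X →₀ K) :=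
  (OpTree.labelled K Ω X).subtype

theorem treeCoeff_treeElt {K : Type u} [Field K] {Ω : Type} {X : Type} [Finite X]
    (t : OpTree Ω X) (ht : t.IsLabelled) :
    treeCoeff (treeElt K t ht) = Finsupp.single t 1 := rfl

/-! ## Quadratic operads and Koszul duality -/

/-- The tree of the operation `ω ∘ (ω', I)`, that is `(x₁ ω' x₂) ω x₃`. -/
def leftTree {Ω : Type} (ω ω' : Ω) : OpTree Ω (Fin 3) :=
  .node ω (.node ω' (.leaf 0) (.leaf 1)) (.leaf 2)

/-- The tree of the operation `ω ∘ (I, ω')`, that is `x₁ ω (x₂ ω' x₃)`. -/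
def rightTree {Ω : Type} (ω ω' : Ω) : OpTree Ω (Fin 3) :=
  .node ω (.leaf 0) (.node ω' (.leaf 1) (.leaf 2))

theorem leftTree_isLabelled {Ω : Type} (ω ω' : Ω) : (leftTree ω ω').IsLabelled := by
  constructor
  · simp [leftTree, OpTree.leaves]
  · intro x
    fin_cases x <;> simp [leftTree, OpTree.leaves]

theorem rightTree_isLabelled {Ω : Type} (ω ω' : Ω) : (rightTree ω ω').IsLabelled := by
  constructor
  · simp [rightTree, OpTree.leaves]
  · intro x
    fin_cases x <;> simp [rightTree, OpTree.leaves]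

/-- `ω ∘ (ω', I)`, in the free operad. -/
def compLeft (K : Type u) [Field K] {Ω : Type} (ω ω' : Ω) :
    (freeBinaryOperad K Ω).obj (Fin 3) := treeElt K (leftTree ω ω') (leftTree_isLabelled ω ω')

/-- `ω ∘ (I, ω')`, in the free operad. -/
def compRight (K : Type u) [Field K] {Ω : Type} (ω ω' : Ω) :
    (freeBinaryOperad K Ω).obj (Fin 3) := treeElt K (rightTree ω ω') (rightTree_isLabelled ω ω')

/-- The binary operad `𝓟(E) / (S)` with generators `Ω` (a basis of the free `S₂`-module `E`) and
quadratic relations `S ⊆ 𝓟(E)(3)`. -/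
def quadraticOperad (K : Type u) [Field K] (Ω : Type)
    (S : Set ((freeBinaryOperad K Ω).obj (Fin 3))) : SymmOperad K :=
  (freeBinaryOperad K Ω).quot (SymmOperad.OpIdeal.span _ S)

/-- The sub-`S₃`-module of `𝓟(E)(3)` generated by a set of relations. -/
def relationModule {K : Type u} [Field K] {Ω : Type}
    (S : Set ((freeBinaryOperad K Ω).obj (Fin 3))) :
    Submodule K ((freeBinaryOperad K Ω).obj (Fin 3)) :=
  Submodule.span K {q | ∃ (σ : Equiv.Perm (Fin 3)), ∃ r ∈ S, q = (freeBinaryOperad K Ω).map σ r}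

/-- The sign of the map `0 ↦ a, 1 ↦ b, 2 ↦ c` (zero if it is not a permutation). -/
def signOf (a b c : Fin 3) : ℤ :=
  Int.sign (((b : ℤ) - (a : ℤ)) * ((c : ℤ) - (a : ℤ)) * ((c : ℤ) - (b : ℤ)))

theorem signOf_perm (σ : Equiv.Perm (Fin 3)) :
    signOf (σ 0) (σ 1) (σ 2) = (Equiv.Perm.sign σ : ℤ) := by
  revert σ
  decide

/-- The sign `⟨t*, t⟩` of the tree `t` in the pairing between `𝓟(E^∨)(3)` and `𝓟(E)(3)`, where
`E^∨ = E* ⊗ sgn`: the sign of the permutation of the leaves, with an additional minus sign for the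
trees of the form `ω ∘ (I, ω')`. -/
def treeSign {Ω : Type} : OpTree Ω (Fin 3) → ℤ
  | .node _ (.node _ (.leaf a) (.leaf b)) (.leaf c) => signOf a b c
  | .node _ (.leaf a) (.node _ (.leaf b) (.leaf c)) => - signOf a b c
  | _ => 0

/-- The pairing `⟨f, r⟩ = ∑ₜ ± f(t) r(t)` of `𝓟(E^∨)(3)` with `𝓟(E)(3)`. The `S₂`-module
`E^∨ = E* ⊗ sgn` is again free, on the elements dual to `Ω`, so that `Ω` also serves as the set of
generators of `𝓟(E^∨)`. -/
def koszulPairing {K : Type u} [Field K] {Ω : Type} (r : (freeBinaryOperad K Ω).obj (Fin 3)) :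
    (freeBinaryOperad K Ω).obj (Fin 3) →ₗ[K] K :=
  (Finsupp.linearCombination K
    (fun t : OpTree Ω (Fin 3) => (treeSign t : K) * treeCoeff r t)) ∘ₗ treeCoeff

/-- The orthogonal `R^⊥ ⊆ 𝓟(E^∨)(3)` of `R ⊆ 𝓟(E)(3)`. -/
def relationOrthogonal {K : Type u} [Field K] {Ω : Type}
    (R : Submodule K ((freeBinaryOperad K Ω).obj (Fin 3))) :
    Submodule K ((freeBinaryOperad K Ω).obj (Fin 3)) :=
  ⨅ r ∈ R, LinearMap.ker (koszulPairing r)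

/-- The Koszul dual `𝓟(E^∨) / (R^⊥)` of the quadratic operad `𝓟(E) / (R)`, where `R` is the
sub-`S₃`-module generated by `S`. -/
def koszulDual (K : Type u) [Field K] (Ω : Type) [Finite Ω]
    (S : Set ((freeBinaryOperad K Ω).obj (Fin 3))) : SymmOperad K :=
  quadraticOperad K Ω (relationOrthogonal (relationModule S) : Set _)

/-! ## The operad `𝓟_↘` and its Koszul dual -/

/-- The two generators `m` and `↘`. -/
inductive Gen : Type
  | m : Gen
  | se : Gen

instance : Finite Gen :=
  Finite.of_surjective (fun b : Bool => if b then Gen.m else Gen.se) (by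
    rintro (_ | _)
    · exact ⟨true, rfl⟩
    · exact ⟨false, rfl⟩)

/-- The relations `↘ ∘ (m, I) = ↘ ∘ (I, ↘)`, `↘ ∘ (I, m) = m ∘ (↘, I)` and
`m ∘ (m, I) = m ∘ (I, m)` of the operad `𝓟_↘`. -/
def seRelations (K : Type u) [Field K] : Set ((freeBinaryOperad K Gen).obj (Fin 3)) :=
  {compLeft K Gen.se Gen.m - compRight K Gen.se Gen.se,
   compRight K Gen.se Gen.m - compLeft K Gen.m Gen.se,
   compLeft K Gen.m Gen.m - compRight K Gen.m Gen.m}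

/-- The operad `𝓟_↘`. -/
def seOperad (K : Type u) [Field K] : SymmOperad K := quadraticOperad K Gen (seRelations K)

/-- The operad `𝓟_↘^!`, the Koszul dual of the quadratic operad `𝓟_↘`. -/
def seDual (K : Type u) [Field K] : SymmOperad K := koszulDual K Gen (seRelations K)

/-- The class of a labelled tree in `𝓟_↘^!`. -/
def seDualTree (K : Type u) [Field K] {X : Type} [Finite X] (t : OpTree Gen X)
    (ht : t.IsLabelled) : (seDual K).obj X :=
  Submodule.Quotient.mk (treeElt K t ht)

/-- The tree of the binary operation `ω`. -/
def genTree (ω : Gen) : OpTree Gen (Fin 2) := .node ω (.leaf 0) (.leaf 1)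

theorem genTree_isLabelled (ω : Gen) : (genTree ω).IsLabelled := by
  constructor
  · simp [genTree, OpTree.leaves]
  · intro x
    fin_cases x <;> simp [genTree, OpTree.leaves]

/-- The generators `m` and `↘` of `𝓟_↘^!`, in `𝓟_↘^!(2)`. -/
def seDualGen (K : Type u) [Field K] (ω : Gen) : (seDual K).obj (Fin 2) :=
  seDualTree K (genTree ω) (genTree_isLabelled ω)

/-- The right comb `x₁ a₁ (x₂ a₂ (⋯ (x_k a_k x)))`. -/
def rightComb {Ω X : Type} : List (X × Ω) → X → OpTree Ω X
  | [], x => .leaf x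
  | (y, ω) :: l, x => .node ω (.leaf y) (rightComb l x)

theorem leaves_rightComb {Ω X : Type} (l : List (X × Ω)) (x : X) :
    (rightComb l x).leaves = l.map Prod.fst ++ [x] := by
  induction l with
  | nil => rfl
  | cons y l ih => simp [rightComb, OpTree.leaves, ih]

/-- The right comb `1 ↘ (2 ↘ (⋯ ↘ (i m (i+1 m (⋯ m n)))))` with `n` leaves, whose first `i - 1`
vertices are `↘` and whose last `n - i` vertices are `m`. (In the code the leaves and the index
`i` are numbered from zero: the first `i` of the `n - 1` vertices are `↘`.) -/
def combTree {n : ℕ} (i : Fin n) : OpTree Gen (Fin n) :=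
  rightComb
    (List.ofFn fun j : Fin (n - 1) =>
      ((⟨j.1, by omega⟩ : Fin n), if j.1 < i.1 then Gen.se else Gen.m))
    ⟨n - 1, by have := i.2; omega⟩

theorem combTree_isLabelled {n : ℕ} (i : Fin n) : (combTree i).IsLabelled := by
  have h : (combTree i).leaves =
      (List.ofFn fun j : Fin (n - 1) => (⟨j.1, by omega⟩ : Fin n)) ++ [⟨n - 1, by have := i.2; omega⟩] := by
    simp [combTree, leaves_rightComb, List.map_ofFn, Function.comp_def]
  constructor
  · rw [h, List.nodup_append']
    refine ⟨List.nodup_ofFn.2 fun a b hab => ?_, by simp, ?_⟩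
    · simpa [Fin.ext_iff] using hab
    · intro x hx hx'
      simp only [List.mem_ofFn, List.mem_singleton] at hx hx'
      obtain ⟨j, rfl⟩ := hx
      have := j.2
      simp only [Fin.mk.injEq] at hx'
      omega
  · intro x
    rw [h, List.mem_append, List.mem_ofFn, List.mem_singleton]
    by_cases hx : x.1 < n - 1
    · exact Or.inl ⟨⟨x.1, hx⟩, rfl⟩
    · exact Or.inr (Fin.ext (by simp; omega))

/-! ## The algebra `T_↘(V)` -/

section TSE

variable (K : Type u) [Field K] (V : Type v) [AddCommGroup V] [Module K V]

/-- `T_↘(V) = ⨁_{n ≥ 1} ⨁_{k = 1}^n V^{⊗ n}`: one copy of `V^{⊗ n}` for each position `k` of the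
point. The index `⟨n, k⟩` has `k : Fin n`, so that positions are numbered from zero and `n = 0`
does not occur. -/
abbrev TSE : Type (max u v) := ⨁ p : (Σ n : ℕ, Fin n), ⨂[K]^p.1 V

/-- The inclusion of the copy of `V^{⊗ n}` whose `k`-th factor is pointed. -/
def TSE.of (n : ℕ) (k : Fin n) : (⨂[K]^n V) →ₗ[K] TSE K V :=
  DirectSum.lof K (Σ n : ℕ, Fin n) (fun p => ⨂[K]^p.1 V) ⟨n, k⟩

/-- Concatenation of tensors. -/
def TSE.concat (m n : ℕ) : (⨂[K]^m V) →ₗ[K] (⨂[K]^n V) →ₗ[K] (⨂[K]^(m + n) V) :=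
  (TensorProduct.mk K (⨂[K]^m V) (⨂[K]^n V)).compr₂
    (TensorPower.mulEquiv (R := K) (M := V) (n := m) (m := n)).toLinearMap

/-- The product `m`: `v w = 0` if the point of `w` is not in the first position, and otherwise
`v w` is the concatenation, with the point of `v`. -/
def TSE.mulM : TSE K V →ₗ[K] TSE K V →ₗ[K] TSE K V :=
  DirectSum.toModule K _ _ fun p => LinearMap.flip <| DirectSum.toModule K _ _ fun q =>
    LinearMap.flip <|
      if q.2.1 = 0 then
        (TSE.concat K V p.1 q.1).compr₂ (TSE.of K V (p.1 + q.1) (Fin.castAdd q.1 p.2))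
      else 0

/-- The product `↘`: `v ↘ w = 0` if the point of `v` is not in the first position, and otherwise
`v ↘ w` is the concatenation, with the point of `w`. -/
def TSE.mulSE : TSE K V →ₗ[K] TSE K V →ₗ[K] TSE K V :=
  DirectSum.toModule K _ _ fun p => LinearMap.flip <| DirectSum.toModule K _ _ fun q =>
    LinearMap.flip <|
      if p.2.1 = 0 then
        (TSE.concat K V p.1 q.1).compr₂ (TSE.of K V (p.1 + q.1) (Fin.natAdd p.1 q.2))
      else 0

/-- The inclusion of `V` as the component of degree one of `T_↘(V)`. -/
def TSE.incl : V →ₗ[K] TSE K V :=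
  TSE.of K V 1 0 ∘ₗ
    (PiTensorProduct.subsingletonEquiv (R := K) (s := fun _ : Fin 1 => V) 0).symm.toLinearMap

end TSE

end

/-! For each labelling of three leaves there are eight decorated trees. The pairing has opposite
signs on left and right trees, so each of the three differences that generate `R` asks that two
coefficients of an element of `R^⊥` sum to zero. Hence a `𝓟_↘^!`-algebra is a vector space with two
bilinear products, `m` (written `xy`) and `↘`, such that `(xy)z = x(yz)`, `(xy) ↘ z = x ↘ (y ↘ z)`,
`(x ↘ y)z = x ↘ (yz)`, `(x ↘ y) ↘ z = 0` and `x(y ↘ z) = 0` (`IsSEDualAlgebra`).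

Upper bound. A right comb `a₁ ↘ (a₂ ↘ (⋯ ↘ (x m (b₁ m ⋯))))` is recorded as the word `a x b` with
pointed letter `x`. The identities say how combs multiply: the product is zero, or the comb of the
concatenated word. It is nonzero for `m` when the right factor is pointed at its first letter, and
the point of the left factor is kept; for `↘` the two factors exchange roles. By induction every
tree is zero or the comb with the same leaves in the same order
(`IsSEDualAlgebra.eval_eq_zero_or_comb`). This is a statement about algebras; it is applied to the
trees with leaves in a set `Z` modulo `treeIdeal`, and `mem_of_mem_treeIdeal` carries it back to the
operad. So the combs span.

Lower bound. The space with basis the pointed words, with these multiplication rules, satisfies the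
five identities (`IsPointedWordFamily.isSEDualAlgebra`). There the relabelled combs take distinct
basis vectors as values, so they are independent (`linearIndependent_combFamily`). The `n · n!`
relabelled combs are thus a basis, and the symmetric group permutes it freely, with orbits indexed
by the `n` combs.

Free algebra. The pure tensors of `T_↘(V)` span it and obey the same rules, so it is an algebra.
Each of them is a comb in elements of degree one, which forces the extension of a linear map `V →
B`; the extension is multiplicative because combs in `B` multiply by the same rules (`TSE.lift_op`).
-/

noncomputable section

/-! ### Algebras over a quotient operad -/

namespace SymmOperad

variable {K : Type u} [Field K] {P : SymmOperad K} {A : Type v} [AddCommGroup A] [Module K A]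

/-- The ideal of the operations that act by zero on an algebra. -/
def AlgStr.ker (𝔞 : P.AlgStr A) : P.OpIdeal where
  carrier X _ := LinearMap.ker (𝔞.act (X := X))
  map_mem e p hp := by
    rw [LinearMap.mem_ker] at *
    ext a
    rw [𝔞.act_map, hp]
    rfl
  comp_mem_left p g hp := by
    rw [LinearMap.mem_ker] at *
    ext a
    rw [𝔞.act_comp, hp]
    rfl
  comp_mem_right p g x hx := by
    rw [LinearMap.mem_ker] at *
    ext a
    rw [𝔞.act_comp]
    exact (𝔞.act p).map_coord_zero x (by rw [hx]; rfl)

theorem OpIdeal.subset_span {n : ℕ} (S : Set (P.obj (Fin n))) :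
    S ⊆ (OpIdeal.span P S).carrier (Fin n) := fun _ hp =>
  (Submodule.mem_iInf _).2 fun I => I.2 hp

theorem OpIdeal.span_le {n : ℕ} {S : Set (P.obj (Fin n))} {I : P.OpIdeal}
    (h : S ⊆ I.carrier (Fin n)) (X : Type) [Finite X] :
    (OpIdeal.span P S).carrier X ≤ I.carrier X :=
  iInf_le (fun I : { I : P.OpIdeal // S ⊆ I.carrier (Fin n) } => I.1.carrier X) ⟨I, h⟩

/-- An algebra on which an ideal acts by zero is an algebra over the quotient operad. -/
def AlgStr.quot (𝔞 : P.AlgStr A) (I : P.OpIdeal)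
    (h : ∀ (X : Type) [Finite X], I.carrier X ≤ 𝔞.ker.carrier X) : (P.quot I).AlgStr A where
  act {X} _ := (I.carrier X).liftQ 𝔞.act (h X)
  act_map e p a := by
    obtain ⟨p, rfl⟩ := Submodule.Quotient.mk_surjective _ p
    exact 𝔞.act_map e p a
  act_one a := 𝔞.act_one a
  act_comp p g a := by
    obtain ⟨p, rfl⟩ := Submodule.Quotient.mk_surjective _ p
    obtain ⟨g, rfl⟩ := I.exists_rep g
    have h : (P.quot I).comp (Submodule.Quotient.mk p) (fun x => Submodule.Quotient.mk (g x)) =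
        Submodule.Quotient.mk (P.comp p g) := I.quotComp_mk p g
    rw [h]
    exact 𝔞.act_comp p g a

/-- An algebra over a quotient operad, as an algebra over the operad. -/
def AlgStr.pullback {I : P.OpIdeal} (𝔟 : (P.quot I).AlgStr A) : P.AlgStr A where
  act {X} _ := 𝔟.act ∘ₗ (I.carrier X).mkQ
  act_map e p a := 𝔟.act_map e (Submodule.Quotient.mk p) a
  act_one a := 𝔟.act_one a
  act_comp p g a := by
    have h : (P.quot I).comp (Submodule.Quotient.mk p) (fun x => Submodule.Quotient.mk (g x)) =
        Submodule.Quotient.mk (P.comp p g) := I.quotComp_mk p g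
    have := 𝔟.act_comp (Submodule.Quotient.mk p) (fun x => Submodule.Quotient.mk (g x)) a
    rw [h] at this
    exact this

end SymmOperad

/-! ### A tree as a shape with a decoration of its leaves -/

namespace OpTree

variable {Ω X Y Z : Type} {K : Type u} [Field K] {A : Type v} [AddCommGroup A] [Module K A]

theorem map_map (f : X → Y) (g : Y → Z) (t : OpTree Ω X) :
    (t.map f).map g = t.map (fun x => g (f x)) := by
  induction t with
  | leaf x => rfl
  | node ω s t hs ht => simp only [map, hs, ht]

theorem eval_map (β : Ω → A →ₗ[K] A →ₗ[K] A) (f : X → Y) (a : Y → A) (t : OpTree Ω X) :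
    (t.map f).eval β a = t.eval β (fun x => a (f x)) := by
  induction t with
  | leaf x => rfl
  | node ω s t hs ht => simp only [map, eval, hs, ht]

/-- The set of leaves of a tree. -/
def Pos : OpTree Ω X → Type
  | leaf _ => Unit
  | node _ s t => s.Pos ⊕ t.Pos

instance finite_pos (t : OpTree Ω X) : Finite t.Pos := by
  induction t with
  | leaf x => exact inferInstanceAs (Finite Unit)
  | node ω s t hs ht => exact inferInstanceAs (Finite (s.Pos ⊕ t.Pos))

/-- The shape of a tree, labelled by its own set of leaves. -/
def shape : (t : OpTree Ω X) → OpTree Ω t.Pos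
  | leaf _ => leaf ()
  | node ω s t => node ω (s.shape.map Sum.inl) (t.shape.map Sum.inr)

/-- The decoration of the leaves of a tree. -/
def label : (t : OpTree Ω X) → t.Pos → X
  | leaf x => fun _ => x
  | node _ s t => Sum.elim s.label t.label

/-- Reduces trees with repeated or missing labels, which do not lie in the operad, to labelled
trees, which do. -/
theorem shape_map_label (t : OpTree Ω X) : t.shape.map t.label = t := by
  induction t with
  | leaf x => rfl
  | node ω s t hs ht =>
    exact congrArg₂ (node ω) ((map_map _ (Sum.elim s.label t.label) _).trans hs)
      ((map_map _ (Sum.elim s.label t.label) _).trans ht)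

theorem IsLabelled.node_sum {s : OpTree Ω X} {t : OpTree Ω Y} (hs : s.IsLabelled)
    (ht : t.IsLabelled) (ω : Ω) : (node ω (s.map Sum.inl) (t.map Sum.inr)).IsLabelled := by
  constructor
  · simp only [leaves, leaves_map, List.nodup_append']
    refine ⟨hs.1.map Sum.inl_injective, ht.1.map Sum.inr_injective, fun z hz hz' => ?_⟩
    obtain ⟨x, -, rfl⟩ := List.mem_map.1 hz
    simp at hz'
  · rintro (x | y) <;> simp [leaves, leaves_map, hs.2, ht.2]

theorem shape_isLabelled (t : OpTree Ω X) : t.shape.IsLabelled := by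
  induction t with
  | leaf x => exact ⟨List.nodup_singleton _, fun _ => List.mem_singleton.2 rfl⟩
  | node ω s t hs ht => exact hs.node_sum ht ω

/-- A map that carries a labelled tree to a labelled tree is a bijection. -/
theorem IsLabelled.bijective {f : X → Y} {t : OpTree Ω X} (h : t.IsLabelled)
    (h' : (t.map f).IsLabelled) : Function.Bijective f := by
  rw [IsLabelled, leaves_map] at h'
  refine ⟨fun x y e => List.inj_on_of_nodup_map h'.1 (h.2 x) (h.2 y) e, fun y => ?_⟩
  obtain ⟨x, -, rfl⟩ := List.mem_map.1 (h'.2 y)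
  exact ⟨x, rfl⟩

end OpTree

open OpTree

/-! ### Algebras over the free operad from bilinear operations -/

section FreeAlg

variable {K : Type u} [Field K] {Ω : Type} {A : Type v} [AddCommGroup A] [Module K A]

/-- Bilinear operations make a vector space an algebra over the free operad. -/
def freeAlg (β : Ω → A →ₗ[K] A →ₗ[K] A) : (freeBinaryOperad K Ω).AlgStr A where
  act {X} _ :=
    { toFun := fun p =>
        { toFun := fun a => evalLin β a p.1
          map_update_add' := fun a x u v => evalLin_update_add β a p.2 x u v
          map_update_smul' := fun a x c u => evalLin_update_smul β a p.2 x c u }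
      map_add' := fun p q => by
        ext a
        exact map_add (evalLin β a) p.1 q.1
      map_smul' := fun c p => by
        ext a
        exact map_smul (evalLin β a) c p.1 }
  act_map e p a := evalLin_mapLin β e a p.1
  act_one a := by
    change evalLin β a (Finsupp.single (leaf ()) 1) = _
    rw [evalLin_single, one_smul]
    rfl
  act_comp p g a := evalLin_compLin β p.1 (fun x => (g x).1) a

theorem freeAlg_act (β : Ω → A →ₗ[K] A →ₗ[K] A) {X : Type} [Finite X]
    (p : (freeBinaryOperad K Ω).obj X) (a : X → A) :
    (freeAlg β).act p a = evalLin β a p.1 := rfl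

theorem map_treeElt {X Y : Type} [Finite X] [Finite Y] (e : X ≃ Y) (t : OpTree Ω X)
    (ht : t.IsLabelled) : (freeBinaryOperad K Ω).map e (treeElt K t ht) =
      treeElt K (t.map e) (ht.map_equiv e) :=
  Subtype.ext (mapLin_single _ _ _)

theorem labelled_hom_ext {M : Type*} [AddCommGroup M] [Module K M] {X : Type}
    {f g : labelled K Ω X →ₗ[K] M}
    (h : ∀ t (ht : t.IsLabelled), f ⟨Finsupp.single t 1, single_mem ht 1⟩ =
      g ⟨Finsupp.single t 1, single_mem ht 1⟩) : f = g := by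
  let e : _ ≃ₗ[K] labelled K Ω X :=
    (Finsupp.supportedEquivFinsupp (M := K) (R := K) {t : OpTree Ω X | t.IsLabelled}).symm
  have key : f ∘ₗ e.toLinearMap = g ∘ₗ e.toLinearMap := by
    refine Finsupp.lhom_ext' fun t => LinearMap.ext_ring ?_
    have he : e (Finsupp.single t 1) = ⟨Finsupp.single t.1 1, single_mem t.2 1⟩ :=
      Subtype.ext (Finsupp.supportedEquivFinsupp_symm_single _ _ _)
    simp only [LinearMap.comp_apply, Finsupp.lsingle_apply, LinearEquiv.coe_coe]
    rw [he]
    exact h t.1 t.2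
  ext p
  have := LinearMap.congr_fun key (e.symm p)
  simpa using this

/-- Linear maps on the free operad are determined by their values on labelled trees. -/
theorem freeBinaryOperad_hom_ext {M : Type*} [AddCommGroup M] [Module K M] {X : Type} [Finite X]
    {f g : (freeBinaryOperad K Ω).obj X →ₗ[K] M}
    (h : ∀ t ht, f (treeElt K t ht) = g (treeElt K t ht)) : f = g :=
  labelled_hom_ext h

end FreeAlg

/-! ### The free operad is generated by its binary operations -/

section Graft

/-- The family of two types. -/
def pairType (X Y : Type) : Fin 2 → Type
  | 0 => X
  | 1 => Y

instance finite_pairType (X Y : Type) [Finite X] [Finite Y] : ∀ i, Finite (pairType X Y i)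
  | 0 => inferInstanceAs (Finite X)
  | 1 => inferInstanceAs (Finite Y)

/-- The disjoint union of a family of two types. -/
def sigmaPairType (X Y : Type) : (Σ i, pairType X Y i) ≃ X ⊕ Y where
  toFun
    | ⟨0, x⟩ => Sum.inl x
    | ⟨1, y⟩ => Sum.inr y
  invFun
    | Sum.inl x => ⟨0, x⟩
    | Sum.inr y => ⟨1, y⟩
  left_inv := by
    rintro ⟨i, x⟩
    fin_cases i <;> rfl
  right_inv := by rintro (x | y) <;> rfl

variable {K : Type u} [Field K]

/-- A pair of operations, as a family. -/
def pairObj (P : SymmOperad K) {X Y : Type} [Finite X] [Finite Y] (p : P.obj X) (q : P.obj Y) :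
    ∀ i, P.obj (pairType X Y i)
  | 0 => p
  | 1 => q

variable (K) in
/-- The generators of the free operad. -/
def genElt (ω : Gen) : (freeBinaryOperad K Gen).obj (Fin 2) :=
  treeElt K (genTree ω) (genTree_isLabelled ω)

theorem treeElt_node {X Y : Type} [Finite X] [Finite Y] (ω : Gen) {s : OpTree Gen X}
    {t : OpTree Gen Y} (hs : s.IsLabelled) (ht : t.IsLabelled) :
    treeElt K (node ω (s.map Sum.inl) (t.map Sum.inr)) (hs.node_sum ht ω) =
      (freeBinaryOperad K Gen).map (sigmaPairType X Y)
        ((freeBinaryOperad K Gen).comp (genElt K ω)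
          (pairObj _ (treeElt K s hs) (treeElt K t ht))) := by
  apply Subtype.ext
  change Finsupp.single _ 1 = mapLin K (sigmaPairType X Y)
    (compLin (Finsupp.single (genTree ω) 1) fun i => (pairObj (freeBinaryOperad K Gen)
      (treeElt K s hs) (treeElt K t ht) i).1)
  rw [mapLin_compLin, evalLin_single, one_smul]
  change _ = opLin K ω (mapLin K Sum.inl (Finsupp.single s 1))
    (mapLin K Sum.inr (Finsupp.single t 1))
  rw [mapLin_single, mapLin_single, opLin_single, mul_one]

variable {A : Type v} [AddCommGroup A] [Module K A]

/-- The bilinear operation of a binary generator. -/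
def SymmOperad.AlgStr.op (𝔟 : (freeBinaryOperad K Gen).AlgStr A) (ω : Gen) :
    A →ₗ[K] A →ₗ[K] A :=
  have h0 : ∀ x y : A, ![x, y] = Function.update ![0, y] 0 x := fun x y => by
    ext i; fin_cases i <;> rfl
  have h1 : ∀ x y : A, ![x, y] = Function.update ![x, 0] 1 y := fun x y => by
    ext i; fin_cases i <;> rfl
  LinearMap.mk₂ K (fun x y => 𝔟.act (genElt K ω) ![x, y])
    (fun x x' y => by rw [h0, MultilinearMap.map_update_add, ← h0, ← h0])
    (fun c x y => by rw [h0, MultilinearMap.map_update_smul, ← h0])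
    (fun x y y' => by rw [h1, MultilinearMap.map_update_add, ← h1, ← h1])
    (fun c x y => by rw [h1, MultilinearMap.map_update_smul, ← h1])

theorem SymmOperad.AlgStr.op_apply (𝔟 : (freeBinaryOperad K Gen).AlgStr A) (ω : Gen) (x y : A) :
    𝔟.op ω x y = 𝔟.act (genElt K ω) ![x, y] := rfl

theorem SymmOperad.AlgStr.act_node (𝔟 : (freeBinaryOperad K Gen).AlgStr A) {X Y : Type}
    [Finite X] [Finite Y] (ω : Gen) {s : OpTree Gen X} {t : OpTree Gen Y} (hs : s.IsLabelled)
    (ht : t.IsLabelled) (a : X ⊕ Y → A) :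
    𝔟.act (treeElt K (node ω (s.map Sum.inl) (t.map Sum.inr)) (hs.node_sum ht ω)) a =
      𝔟.op ω (𝔟.act (treeElt K s hs) fun x => a (Sum.inl x))
        (𝔟.act (treeElt K t ht) fun y => a (Sum.inr y)) := by
  rw [treeElt_node ω hs ht, 𝔟.act_map, 𝔟.act_comp, 𝔟.op_apply]
  congr 1
  ext i
  fin_cases i <;> rfl

/-- Structural induction works for shapes because their leaves form a disjoint union at every
vertex, so that each vertex is one operadic composition with a generator. -/
theorem SymmOperad.AlgStr.act_shape (𝔟 : (freeBinaryOperad K Gen).AlgStr A) {X : Type}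
    (t : OpTree Gen X) (a : t.Pos → A) :
    𝔟.act (treeElt K t.shape t.shape_isLabelled) a = t.shape.eval 𝔟.op a := by
  induction t with
  | leaf x => exact 𝔟.act_one a
  | node ω s t hs ht =>
    refine (𝔟.act_node ω s.shape_isLabelled t.shape_isLabelled a).trans ?_
    exact congrArg₂ (fun x y => 𝔟.op ω x y)
      ((hs fun x => a (Sum.inl x)).trans (eval_map 𝔟.op Sum.inl a s.shape).symm)
      ((ht fun x => a (Sum.inr x)).trans (eval_map 𝔟.op Sum.inr a t.shape).symm)

/-- The action of the free operad is determined by the operations of the generators. -/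
theorem SymmOperad.AlgStr.act_eq_evalLin (𝔟 : (freeBinaryOperad K Gen).AlgStr A) {X : Type}
    [Finite X] (p : (freeBinaryOperad K Gen).obj X) (a : X → A) :
    𝔟.act p a = evalLin 𝔟.op a p.1 := by
  have h : 𝔟.act (X := X) = (freeAlg 𝔟.op).act := by
    refine freeBinaryOperad_hom_ext fun t ht => ?_
    ext a
    -- A labelled tree is its own shape relabelled along a bijection, so equivariance reduces the
    -- claim to shapes.
    let e := Equiv.ofBijective t.label
      (t.shape_isLabelled.bijective (by rw [shape_map_label]; exact ht))
    have he : treeElt K t ht = (freeBinaryOperad K Gen).map e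
        (treeElt K t.shape t.shape_isLabelled) := by
      rw [map_treeElt]
      exact Subtype.ext (congrArg (Finsupp.single · 1) t.shape_map_label.symm)
    rw [he, 𝔟.act_map, act_shape, AlgStr.act_map, freeAlg_act]
    change _ = evalLin _ _ (Finsupp.single _ 1)
    rw [evalLin_single, one_smul]
  rw [h, freeAlg_act]

end Graft

/-! ### The relations orthogonal to those of `𝓟_↘` -/

section Relations

variable {K : Type u} [Field K] {A : Type v} [AddCommGroup A] [Module K A]

instance : Fintype Gen := ⟨Finset.mk [Gen.m, Gen.se] (by simp), by rintro (_ | _) <;> simp⟩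

theorem Gen.sum_univ {M : Type*} [AddCommMonoid M] (f : Gen → M) :
    ∑ ω, f ω = f Gen.m + f Gen.se := by
  simp [Finset.sum, Finset.univ, Fintype.elems]

/-- The relations between the operations `m` and `↘` of an algebra over `𝓟_↘^!`. -/
structure IsSEDualAlgebra (β : Gen → A →ₗ[K] A →ₗ[K] A) : Prop where
  m_assoc : ∀ x y z, β .m (β .m x y) z = β .m x (β .m y z)
  m_se : ∀ x y z, β .se (β .m x y) z = β .se x (β .se y z)
  se_m : ∀ x y z, β .m (β .se x y) z = β .se x (β .m y z)
  se_se : ∀ x y z, β .se (β .se x y) z = 0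
  m_se_zero : ∀ x y z, β .m x (β .se y z) = 0

theorem koszulPairing_treeElt {Ω : Type} (f : (freeBinaryOperad K Ω).obj (Fin 3))
    (t : OpTree Ω (Fin 3)) (ht : t.IsLabelled) :
    koszulPairing f (treeElt K t ht) = treeSign t * treeCoeff f t := by
  simp [koszulPairing, treeCoeff_treeElt]

/-- Symmetry moves the relation into the linear argument, so that orthogonality need only be tested
on generators of the relation module. -/
theorem koszulPairing_comm {Ω : Type} (r f : (freeBinaryOperad K Ω).obj (Fin 3)) :
    koszulPairing r f = koszulPairing f r := by
  classical
  have key : ∀ r f : (freeBinaryOperad K Ω).obj (Fin 3), koszulPairing r f =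
      ∑ t ∈ (treeCoeff r).support ∪ (treeCoeff f).support,
        treeSign t * (treeCoeff r t * treeCoeff f t) := fun r f => by
    simp only [koszulPairing, LinearMap.comp_apply, Finsupp.linearCombination_apply]
    rw [Finsupp.sum_of_support_subset _ Finset.subset_union_right _ (by simp)]
    refine Finset.sum_congr rfl fun t _ => ?_
    rw [smul_eq_mul]
    ring
  rw [key, key, Finset.union_comm]
  refine Finset.sum_congr rfl fun t _ => ?_
  ring

theorem mem_relationOrthogonal_iff {Ω : Type} {S : Set ((freeBinaryOperad K Ω).obj (Fin 3))}
    {f : (freeBinaryOperad K Ω).obj (Fin 3)} : f ∈ relationOrthogonal (relationModule S) ↔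
      ∀ r ∈ S, ∀ σ : Equiv.Perm (Fin 3),
        koszulPairing f ((freeBinaryOperad K Ω).map σ r) = 0 := by
  simp only [relationOrthogonal, Submodule.mem_iInf, LinearMap.mem_ker]
  constructor
  · intro h r hr σ
    rw [← koszulPairing_comm]
    exact h _ (Submodule.subset_span ⟨σ, r, hr, rfl⟩)
  · intro h r hr
    rw [koszulPairing_comm]
    have : relationModule S ≤ LinearMap.ker (koszulPairing f) := by
      refine Submodule.span_le.2 ?_
      rintro _ ⟨σ, r, hr, rfl⟩
      exact h r hr σ
    exact this hr

theorem treeSign_leftTree {Ω : Type} (ω ω' : Ω) (σ : Equiv.Perm (Fin 3)) :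
    treeSign ((leftTree ω ω').map σ) = Equiv.Perm.sign σ := signOf_perm σ

theorem treeSign_rightTree {Ω : Type} (ω ω' : Ω) (σ : Equiv.Perm (Fin 3)) :
    treeSign ((rightTree ω ω').map σ) = -Equiv.Perm.sign σ := congrArg Neg.neg (signOf_perm σ)

/-- A sign is a unit in every characteristic, two included, so the signs of permutations drop out of
the orthogonality equations. -/
theorem intCast_sign_mul_eq_zero {n : ℕ} (σ : Equiv.Perm (Fin n)) (c : K) :
    ((Equiv.Perm.sign σ : ℤ) : K) * c = 0 ↔ c = 0 := by
  rcases Int.units_eq_one_or (Equiv.Perm.sign σ) with h | h <;> simp [h]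

theorem koszulPairing_leftTree {Ω : Type} (f : (freeBinaryOperad K Ω).obj (Fin 3)) (ω ω' : Ω)
    (σ : Equiv.Perm (Fin 3)) :
    koszulPairing f ((freeBinaryOperad K Ω).map σ (compLeft K ω ω')) =
      ((Equiv.Perm.sign σ : ℤ) : K) * treeCoeff f ((leftTree ω ω').map σ) := by
  rw [compLeft, map_treeElt, koszulPairing_treeElt, treeSign_leftTree]

theorem koszulPairing_rightTree {Ω : Type} (f : (freeBinaryOperad K Ω).obj (Fin 3)) (ω ω' : Ω)
    (σ : Equiv.Perm (Fin 3)) :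
    koszulPairing f ((freeBinaryOperad K Ω).map σ (compRight K ω ω')) =
      -(((Equiv.Perm.sign σ : ℤ) : K) * treeCoeff f ((rightTree ω ω').map σ)) := by
  rw [compRight, map_treeElt, koszulPairing_treeElt, treeSign_rightTree, Int.cast_neg, neg_mul]

/-- The pairing gives left and right trees opposite signs, which is why the differences in the
relations become sums of coefficients here. -/
theorem mem_seRelations_orthogonal_iff {f : (freeBinaryOperad K Gen).obj (Fin 3)} :
    f ∈ relationOrthogonal (relationModule (seRelations K)) ↔ ∀ σ : Equiv.Perm (Fin 3),
      treeCoeff f ((leftTree .se .m).map σ) + treeCoeff f ((rightTree .se .se).map σ) = 0 ∧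
      treeCoeff f ((rightTree .se .m).map σ) + treeCoeff f ((leftTree .m .se).map σ) = 0 ∧
      treeCoeff f ((leftTree .m .m).map σ) + treeCoeff f ((rightTree .m .m).map σ) = 0 := by
  rw [mem_relationOrthogonal_iff]
  simp only [seRelations, Set.mem_insert_iff, Set.mem_singleton_iff, forall_eq_or_imp, forall_eq,
    map_sub, koszulPairing_leftTree, koszulPairing_rightTree, sub_neg_eq_add, ← mul_add,
    ← neg_add', intCast_sign_mul_eq_zero, neg_eq_zero, forall_and]

theorem leftTree_map_eq_iff {Ω : Type} {ω ω' υ υ' : Ω} {σ : Equiv.Perm (Fin 3)} :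
    leftTree ω ω' = (leftTree υ υ').map σ ↔
      (ω = υ ∧ ω' = υ') ∧ 0 = σ 0 ∧ 1 = σ 1 ∧ 2 = σ 2 := by
  simp only [leftTree, OpTree.map, node.injEq, leaf.injEq]
  tauto

theorem rightTree_map_eq_iff {Ω : Type} {ω ω' υ υ' : Ω} {σ : Equiv.Perm (Fin 3)} :
    rightTree ω ω' = (rightTree υ υ').map σ ↔
      (ω = υ ∧ ω' = υ') ∧ 0 = σ 0 ∧ 1 = σ 1 ∧ 2 = σ 2 := by
  simp only [rightTree, OpTree.map, node.injEq, leaf.injEq]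
  tauto

theorem leftTree_ne_rightTree {Ω : Type} {ω ω' υ υ' : Ω} {σ : Equiv.Perm (Fin 3)} :
    leftTree ω ω' ≠ (rightTree υ υ').map σ := by
  simp [leftTree, rightTree, OpTree.map]

theorem rightTree_ne_leftTree {Ω : Type} {ω ω' υ υ' : Ω} {σ : Equiv.Perm (Fin 3)} :
    rightTree ω ω' ≠ (leftTree υ υ').map σ := by
  simp [leftTree, rightTree, OpTree.map]

variable (K) in
/-- The relations of `𝓟_↘^!`. -/
theorem seDual_relations_mem :
    compLeft K Gen.m Gen.m - compRight K Gen.m Gen.m ∈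
        relationOrthogonal (relationModule (seRelations K)) ∧
      compLeft K Gen.se Gen.m - compRight K Gen.se Gen.se ∈
        relationOrthogonal (relationModule (seRelations K)) ∧
      compLeft K Gen.m Gen.se - compRight K Gen.se Gen.m ∈
        relationOrthogonal (relationModule (seRelations K)) ∧
      compLeft K Gen.se Gen.se ∈ relationOrthogonal (relationModule (seRelations K)) ∧
      compRight K Gen.m Gen.se ∈ relationOrthogonal (relationModule (seRelations K)) := by
  classical
  simp only [mem_seRelations_orthogonal_iff, map_sub, compLeft, compRight, treeCoeff_treeElt,
    Finsupp.sub_apply, Finsupp.single_apply, leftTree_map_eq_iff, rightTree_map_eq_iff,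
    leftTree_ne_rightTree, rightTree_ne_leftTree, reduceCtorEq, and_false, false_and, if_false,
    true_and]
  simp

theorem exists_perm_of_nodup {a b c : Fin 3} (h : [a, b, c].Nodup) :
    ∃ σ : Equiv.Perm (Fin 3), σ 0 = a ∧ σ 1 = b ∧ σ 2 = c := by
  have hinj : Function.Injective ![a, b, c] := by
    rw [← List.nodup_ofFn]
    simpa using h
  exact ⟨Equiv.ofBijective _ (Finite.injective_iff_bijective.1 hinj), rfl, rfl, rfl⟩

/-- The trees with three leaves. -/
def ternaryTree {Ω : Type} : (Equiv.Perm (Fin 3) × Ω × Ω) ⊕ (Equiv.Perm (Fin 3) × Ω × Ω) →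
    OpTree Ω (Fin 3) :=
  Sum.elim (fun p => (leftTree p.2.1 p.2.2).map p.1) (fun p => (rightTree p.2.1 p.2.2).map p.1)

theorem ternaryTree_injective {Ω : Type} : Function.Injective (ternaryTree (Ω := Ω)) := by
  rintro (⟨σ, ω, ω'⟩ | ⟨σ, ω, ω'⟩) (⟨τ, υ, υ'⟩ | ⟨τ, υ, υ'⟩) h <;>
    simp only [ternaryTree, Sum.elim_inl, Sum.elim_inr, leftTree, rightTree, OpTree.map,
      node.injEq, leaf.injEq, reduceCtorEq, and_false] at h
  · obtain ⟨rfl, ⟨rfl, h0, h1⟩, h2⟩ := h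
    obtain rfl : σ = τ := by ext i; fin_cases i <;> simp [h0, h1, h2]
    rfl
  · obtain ⟨rfl, h0, rfl, h1, h2⟩ := h
    obtain rfl : σ = τ := by ext i; fin_cases i <;> simp [h0, h1, h2]
    rfl

theorem length_leaves_pos {Ω X : Type} (t : OpTree Ω X) : 0 < t.leaves.length := by
  cases t with
  | leaf x => simp [leaves]
  | node ω s t =>
    have := length_leaves_pos s
    simp only [leaves, List.length_append]
    omega

theorem exists_leaf_of_length {Ω X : Type} {t : OpTree Ω X} (h : t.leaves.length = 1) :
    ∃ x, t = leaf x := by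
  cases t with
  | leaf x => exact ⟨x, rfl⟩
  | node ω s t =>
    have := length_leaves_pos s
    have := length_leaves_pos t
    simp only [leaves, List.length_append] at h
    omega

theorem exists_node_of_length {Ω X : Type} {t : OpTree Ω X} (h : t.leaves.length = 2) :
    ∃ ω x y, t = node ω (leaf x) (leaf y) := by
  cases t with
  | leaf x => simp [leaves] at h
  | node ω s t =>
    have := length_leaves_pos s
    have := length_leaves_pos t
    simp only [leaves, List.length_append] at h
    obtain ⟨x, rfl⟩ := exists_leaf_of_length (t := s) (by omega)
    obtain ⟨y, rfl⟩ := exists_leaf_of_length (t := t) (by omega)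
    exact ⟨ω, x, y, rfl⟩

theorem mem_range_ternaryTree {Ω : Type} {t : OpTree Ω (Fin 3)} (ht : t.IsLabelled) :
    t ∈ Set.range (ternaryTree (Ω := Ω)) := by
  have hl : t.leaves.length = 3 := by
    have h := List.toFinset_card_of_nodup ht.1
    rw [Finset.eq_univ_of_forall (s := t.leaves.toFinset) (fun x => List.mem_toFinset.2 (ht.2 x))]
      at h
    simpa using h.symm
  cases t with
  | leaf x => simp [leaves] at hl
  | node ω s t =>
    have hs := length_leaves_pos s
    have ht' := length_leaves_pos t
    simp only [leaves, List.length_append] at hl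
    rcases (by omega : s.leaves.length = 2 ∧ t.leaves.length = 1 ∨
      s.leaves.length = 1 ∧ t.leaves.length = 2) with ⟨h1, h2⟩ | ⟨h1, h2⟩
    · obtain ⟨ω', a, b, rfl⟩ := exists_node_of_length h1
      obtain ⟨c, rfl⟩ := exists_leaf_of_length h2
      obtain ⟨σ, rfl, rfl, rfl⟩ := exists_perm_of_nodup ht.1
      exact ⟨Sum.inl (σ, ω, ω'), rfl⟩
    · obtain ⟨a, rfl⟩ := exists_leaf_of_length h1
      obtain ⟨ω', b, c, rfl⟩ := exists_node_of_length h2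
      obtain ⟨σ, rfl, rfl, rfl⟩ := exists_perm_of_nodup ht.1
      exact ⟨Sum.inr (σ, ω, ω'), rfl⟩

/-- Expanding `f` in the eight trees of each labelling and cancelling in pairs makes it unnecessary
to prove that the five relations generate the whole orthogonal. -/
theorem IsSEDualAlgebra.evalLin_eq_zero {β : Gen → A →ₗ[K] A →ₗ[K] A} (hβ : IsSEDualAlgebra β)
    {f : (freeBinaryOperad K Gen).obj (Fin 3)}
    (hf : f ∈ relationOrthogonal (relationModule (seRelations K))) (a : Fin 3 → A) :
    evalLin β a f.1 = 0 := by
  have hsupp : (f.1.support : Set _) ⊆ Set.range (ternaryTree (Ω := Gen)) := fun t ht =>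
    mem_range_ternaryTree (f.2 ht)
  rw [← Finsupp.mapDomain_comapDomain _ ternaryTree_injective f.1 hsupp, evalLin,
    Finsupp.linearCombination_mapDomain, Finsupp.linearCombination_apply,
    Finsupp.sum_fintype _ _ (fun i => zero_smul K ((eval β a ∘ ternaryTree) i)),
    Fintype.sum_sum_type, Fintype.sum_prod_type,
    Fintype.sum_prod_type, ← Finset.sum_add_distrib]
  refine Finset.sum_eq_zero fun σ _ => ?_
  obtain ⟨h1, h2, h3⟩ := mem_seRelations_orthogonal_iff.1 hf σ
  -- Three of the eight coefficients are eliminated. Of the remaining terms, three pairs cancel by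
  -- the first three identities of the algebra, and the trees `(x ↘ y) ↘ z` and `x m (y ↘ z)`
  -- evaluate to zero.
  replace h1 : f.1 ((leftTree .se .m).map σ) = -f.1 ((rightTree .se .se).map σ) :=
    eq_neg_of_add_eq_zero_left h1
  replace h2 : f.1 ((rightTree .se .m).map σ) = -f.1 ((leftTree .m .se).map σ) :=
    eq_neg_of_add_eq_zero_left h2
  replace h3 : f.1 ((leftTree .m .m).map σ) = -f.1 ((rightTree .m .m).map σ) :=
    eq_neg_of_add_eq_zero_left h3
  simp only [Fintype.sum_prod_type, Gen.sum_univ, Finsupp.comapDomain_apply, ternaryTree,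
    Sum.elim_inl, Sum.elim_inr, Function.comp_apply, h1, h2, h3]
  simp only [leftTree, rightTree, OpTree.map, eval, hβ.m_assoc, hβ.m_se, hβ.se_m, hβ.se_se,
    hβ.m_se_zero, smul_zero, neg_smul]
  abel

end Relations

/-! ### Algebras over `𝓟_↘^!` as vector spaces with two products -/

section SEDualAlgebra

variable {K : Type u} [Field K] {A : Type v} [AddCommGroup A] [Module K A]

variable (K) in
/-- The ideal of relations of `𝓟_↘^!`. -/
def seDualIdeal : (freeBinaryOperad K Gen).OpIdeal :=
  SymmOperad.OpIdeal.span _ (n := 3) (relationOrthogonal (relationModule (seRelations K)) : Set _)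

variable {β : Gen → A →ₗ[K] A →ₗ[K] A}

theorem isSEDualAlgebra_of_evalLin
    (h : ∀ f ∈ relationOrthogonal (relationModule (seRelations K)),
      ∀ a : Fin 3 → A, evalLin β a f.1 = 0) : IsSEDualAlgebra β := by
  obtain ⟨h1, h2, h3, h4, h5⟩ := seDual_relations_mem K
  have hl : ∀ ω ω' a, evalLin β a (compLeft K ω ω').1 = β ω (β ω' (a 0) (a 1)) (a 2) :=
    fun ω ω' a => (evalLin_single _ _ _ _).trans (one_smul _ _)
  have hr : ∀ ω ω' a, evalLin β a (compRight K ω ω').1 = β ω (a 0) (β ω' (a 1) (a 2)) :=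
    fun ω ω' a => (evalLin_single _ _ _ _).trans (one_smul _ _)
  have hsub : ∀ (p q : (freeBinaryOperad K Gen).obj (Fin 3)) (a : Fin 3 → A),
      evalLin β a (p - q).1 = evalLin β a p.1 - evalLin β a q.1 :=
    fun p q a => map_sub (evalLin β a) p.1 q.1
  constructor
  · intro x y z
    have := h _ h1 ![x, y, z]
    rwa [hsub, hl, hr, sub_eq_zero] at this
  · intro x y z
    have := h _ h2 ![x, y, z]
    rwa [hsub, hl, hr, sub_eq_zero] at this
  · intro x y z
    have := h _ h3 ![x, y, z]
    rwa [hsub, hl, hr, sub_eq_zero] at this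
  · intro x y z
    have := h _ h4 ![x, y, z]
    rwa [hl] at this
  · intro x y z
    have := h _ h5 ![x, y, z]
    rwa [hr] at this

theorem IsSEDualAlgebra.seDualIdeal_le (hβ : IsSEDualAlgebra β) (X : Type) [Finite X] :
    (seDualIdeal K).carrier X ≤ (freeAlg β).ker.carrier X :=
  SymmOperad.OpIdeal.span_le (fun _ hf =>
    LinearMap.mem_ker.2 (MultilinearMap.ext fun a => hβ.evalLin_eq_zero hf a)) X

/-- Bilinear operations that satisfy the relations define an algebra over `𝓟_↘^!`. -/
def IsSEDualAlgebra.algStr (hβ : IsSEDualAlgebra β) : (seDual K).AlgStr A :=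
  (freeAlg β).quot (seDualIdeal K) hβ.seDualIdeal_le

theorem IsSEDualAlgebra.algStr_act_tree (hβ : IsSEDualAlgebra β) {X : Type} [Finite X]
    (t : OpTree Gen X) (ht : t.IsLabelled) (a : X → A) :
    hβ.algStr.act (seDualTree K t ht) a = t.eval β a :=
  (evalLin_single _ _ _ _).trans (one_smul _ _)

/-- The operations `m` and `↘` of an algebra over `𝓟_↘^!`. -/
def seDualOp (𝔟 : (seDual K).AlgStr A) : Gen → A →ₗ[K] A →ₗ[K] A :=
  SymmOperad.AlgStr.op (SymmOperad.AlgStr.pullback (I := seDualIdeal K) 𝔟)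

theorem seDualOp_apply (𝔟 : (seDual K).AlgStr A) (ω : Gen) (x y : A) :
    seDualOp 𝔟 ω x y = 𝔟.act (seDualGen K ω) ![x, y] := rfl

theorem seDual_act_mk (𝔟 : (seDual K).AlgStr A) {X : Type} [Finite X]
    (p : (freeBinaryOperad K Gen).obj X) (a : X → A) :
    𝔟.act (Submodule.Quotient.mk p : (seDual K).obj X) a = evalLin (seDualOp 𝔟) a p.1 :=
  SymmOperad.AlgStr.act_eq_evalLin (SymmOperad.AlgStr.pullback (I := seDualIdeal K) 𝔟) p a

theorem seDual_act_tree (𝔟 : (seDual K).AlgStr A) {X : Type} [Finite X]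
    (t : OpTree Gen X) (ht : t.IsLabelled) (a : X → A) :
    𝔟.act (seDualTree K t ht) a = t.eval (seDualOp 𝔟) a :=
  (seDual_act_mk 𝔟 _ a).trans ((evalLin_single _ _ _ _).trans (one_smul _ _))

/-- An element of the orthogonal is zero in the quotient operad, hence acts by zero; its action is
evaluation with the operations of the generators. -/
theorem isSEDualAlgebra_seDualOp (𝔟 : (seDual K).AlgStr A) : IsSEDualAlgebra (seDualOp 𝔟) := by
  refine isSEDualAlgebra_of_evalLin fun f hf a => ?_
  have hf' : f ∈ (seDualIdeal K).carrier (Fin 3) := SymmOperad.OpIdeal.subset_span _ hf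
  rw [← seDual_act_mk 𝔟 f a]
  have h0 : (Submodule.Quotient.mk f : (seDual K).obj (Fin 3)) = (0 : (seDual K).obj (Fin 3)) :=
    (Submodule.Quotient.mk_eq_zero _).2 hf'
  have h1 := (congrArg 𝔟.act h0).trans (map_zero 𝔟.act)
  exact congrArg (fun M => M a) h1

end SEDualAlgebra

/-! ### The algebra of trees modulo an operadic ideal -/

section TreeIdeal

variable {K : Type u} [Field K] (I : (freeBinaryOperad K Gen).OpIdeal) (Z : Type)

/-- The linear combinations of trees with arbitrarily decorated leaves that vanish modulo an
operadic ideal. -/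
def treeIdeal : Submodule K (OpTree Gen Z →₀ K) :=
  Submodule.span K {q | ∃ (Y : Type) (_ : Finite Y), ∃ p ∈ I.carrier Y, ∃ φ : Y → Z,
    q = mapLin K φ p.1}

variable {I Z}

/-- By multilinearity it suffices to substitute single trees. Substituting their shapes is an
operadic composition, which stays in the ideal; the labels are restored afterwards by a map of
leaves, possibly not injective. -/
theorem evalLin_mem_treeIdeal {Y : Type} [Finite Y] {p : (freeBinaryOperad K Gen).obj Y}
    (hp : p ∈ I.carrier Y) (a : Y → OpTree Gen Z →₀ K) :
    evalLin (opLin K) a p.1 ∈ treeIdeal I Z := by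
  have key : (treeIdeal I Z).mkQ.compMultilinearMap ((freeAlg (opLin K)).act p) = 0 := by
    refine Module.Basis.ext_multilinear (fun _ => Finsupp.basisSingleOne) fun v => ?_
    simp only [Finsupp.coe_basisSingleOne, LinearMap.compMultilinearMap_apply,
      Submodule.mkQ_apply, zero_apply, Submodule.Quotient.mk_eq_zero]
    refine Submodule.subset_span ⟨Σ y, (v y).Pos, inferInstance,
      (freeBinaryOperad K Gen).comp p (fun y => treeElt K (v y).shape (v y).shape_isLabelled),
      I.comp_mem_left _ _ hp, fun z => (v z.1).label z.2, ?_⟩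
    rw [freeAlg_act]
    refine Eq.trans ?_ (mapLin_compLin _ _ _).symm
    refine congrArg (fun a => evalLin (opLin K) a p.1) (funext fun y => ?_)
    change _ = mapLin K _ (Finsupp.single _ 1)
    rw [mapLin_single]
    exact congrArg (Finsupp.single · 1) (v y).shape_map_label.symm
  have := congrArg (fun M => M a) key
  simpa [freeAlg_act] using this

theorem opLin_eq_evalLin (ω : Gen) {X Y : Type} [Finite X] [Finite Y]
    (p : (freeBinaryOperad K Gen).obj X) (q : (freeBinaryOperad K Gen).obj Y)
    (a : X ⊕ Y → OpTree Gen Z →₀ K) :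
    opLin K ω (evalLin (opLin K) (fun x => a (Sum.inl x)) p.1)
        (evalLin (opLin K) (fun y => a (Sum.inr y)) q.1) =
      evalLin (opLin K) (fun z => a (sigmaPairType X Y z))
        ((freeBinaryOperad K Gen).comp (genElt K ω) (pairObj _ p q)).1 := by
  refine Eq.trans ?_ ((freeAlg (opLin K)).act_comp (genElt K ω) (pairObj _ p q) _).symm
  refine Eq.trans ?_ (evalLin_single _ _ _ _).symm
  rw [one_smul]
  rfl

theorem evalLin_one (β : Gen → (OpTree Gen Z →₀ K) →ₗ[K] (OpTree Gen Z →₀ K) →ₗ[K]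
    (OpTree Gen Z →₀ K)) (f : OpTree Gen Z →₀ K) :
    evalLin β (fun _ => f) (freeBinaryOperad K Gen).one.1 = f :=
  (evalLin_single _ _ _ _).trans (one_smul _ _)

/-- The product is the value of the composition of the generator with `p` and the unit, where the
one extra leaf receives `f`; that composition lies in the ideal. -/
theorem opLin_mem_treeIdeal_left (ω : Gen) {q : OpTree Gen Z →₀ K} (hq : q ∈ treeIdeal I Z)
    (f : OpTree Gen Z →₀ K) : opLin K ω q f ∈ treeIdeal I Z := by
  have : treeIdeal I Z ≤ (treeIdeal I Z).comap ((opLin K ω).flip f) := by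
    refine Submodule.span_le.2 ?_
    rintro _ ⟨Y, _, p, hp, φ, rfl⟩
    have h := opLin_eq_evalLin ω p (freeBinaryOperad K Gen).one
      (Sum.elim (fun x => Finsupp.single (leaf (φ x)) 1) (fun _ => f))
    simp only [Sum.elim_inl, Sum.elim_inr, evalLin_leaf, evalLin_one] at h
    change opLin K ω (mapLin K φ p.1) f ∈ treeIdeal I Z
    rw [h]
    exact evalLin_mem_treeIdeal (I.comp_mem_right _ _ 0 hp) _
  exact this hq

theorem opLin_mem_treeIdeal_right (ω : Gen) {q : OpTree Gen Z →₀ K} (hq : q ∈ treeIdeal I Z)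
    (f : OpTree Gen Z →₀ K) : opLin K ω f q ∈ treeIdeal I Z := by
  have : treeIdeal I Z ≤ (treeIdeal I Z).comap (opLin K ω f) := by
    refine Submodule.span_le.2 ?_
    rintro _ ⟨Y, _, p, hp, φ, rfl⟩
    have h := opLin_eq_evalLin ω (freeBinaryOperad K Gen).one p
      (Sum.elim (fun _ => f) (fun x => Finsupp.single (leaf (φ x)) 1))
    simp only [Sum.elim_inl, Sum.elim_inr, evalLin_leaf, evalLin_one] at h
    change opLin K ω f (mapLin K φ p.1) ∈ treeIdeal I Z
    rw [h]
    exact evalLin_mem_treeIdeal (I.comp_mem_right _ _ 1 hp) _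
  exact this hq

variable (I Z) in
/-- The operations on the quotient by the ideal of trees. -/
def quotOp (ω : Gen) : ((OpTree Gen Z →₀ K) ⧸ treeIdeal I Z) →ₗ[K]
    ((OpTree Gen Z →₀ K) ⧸ treeIdeal I Z) →ₗ[K] ((OpTree Gen Z →₀ K) ⧸ treeIdeal I Z) :=
  (treeIdeal I Z).liftQ
    { toFun := fun f => (treeIdeal I Z).mapQ (treeIdeal I Z) (opLin K ω f)
        fun _ hq => opLin_mem_treeIdeal_right ω hq f
      map_add' := fun f g => by
        ext
        simp
      map_smul' := fun c f => by
        ext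
        simp }
    (by
      intro q hq
      rw [LinearMap.mem_ker]
      refine LinearMap.ext fun f => ?_
      obtain ⟨f, rfl⟩ := Submodule.Quotient.mk_surjective _ f
      exact (Submodule.Quotient.mk_eq_zero _).2 (opLin_mem_treeIdeal_left ω hq f))

theorem mkQ_opLin (ω : Gen) (f g : OpTree Gen Z →₀ K) :
    (treeIdeal I Z).mkQ (opLin K ω f g) =
      quotOp I Z ω ((treeIdeal I Z).mkQ f) ((treeIdeal I Z).mkQ g) := rfl

/-- This is the algebra in which identities of algebras are turned into identities in the operad. -/
theorem isSEDualAlgebra_quotOp : IsSEDualAlgebra (quotOp (seDualIdeal K) Z) := by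
  refine isSEDualAlgebra_of_evalLin fun f hf a => ?_
  have ha : a = fun i => (treeIdeal (seDualIdeal K) Z).mkQ (a i).out :=
    funext fun i => (Submodule.Quotient.mk_out (a i)).symm
  rw [ha, ← hom_evalLin (opLin K) _ (treeIdeal (seDualIdeal K) Z).mkQ mkQ_opLin]
  exact (Submodule.Quotient.mk_eq_zero _).2
    (evalLin_mem_treeIdeal (SymmOperad.OpIdeal.subset_span _ hf) _)

theorem mkQ_single (t : OpTree Gen Z) :
    (treeIdeal I Z).mkQ (Finsupp.single t 1) =
      t.eval (quotOp I Z) (fun z => (treeIdeal I Z).mkQ (Finsupp.single (leaf z) 1)) := by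
  have h := hom_evalLin (opLin K) (quotOp I Z) (treeIdeal I Z).mkQ mkQ_opLin
    (fun z => Finsupp.single (leaf z) 1) (Finsupp.single t 1)
  rw [evalLin_leaf (fun z : Z => z), mapLin_id, evalLin_single, one_smul] at h
  exact h

/-- Projecting onto labelled trees retracts `treeIdeal` onto the operadic ideal: a relabelling along
a bijection stays in the ideal, and any other relabelling of a labelled tree is no longer labelled
and is killed. -/
theorem mem_of_mem_treeIdeal [Finite Z] {p : (freeBinaryOperad K Gen).obj Z}
    (hp : p.1 ∈ treeIdeal I Z) : p ∈ I.carrier Z := by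
  classical
  -- The projection that forgets every tree whose leaves are not in bijection with `Z`.
  let pr : (OpTree Gen Z →₀ K) →ₗ[K] (freeBinaryOperad K Gen).obj Z :=
    Finsupp.restrictDom K K {t : OpTree Gen Z | t.IsLabelled}
  have hpr : ∀ q : (freeBinaryOperad K Gen).obj Z, pr q.1 = q := fun q =>
    Subtype.ext ((Finsupp.filter_eq_self_iff _ _).2 fun t ht => q.2 (Finsupp.mem_support_iff.2 ht))
  have key : treeIdeal I Z ≤ (I.carrier Z).comap pr := by
    refine Submodule.span_le.2 ?_
    rintro _ ⟨Y, _, p, hp, φ, rfl⟩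
    change pr (mapLin K φ p.1) ∈ I.carrier Z
    by_cases hφ : Function.Bijective φ
    · have := I.map_mem (Equiv.ofBijective φ hφ) p hp
      rw [← hpr ((freeBinaryOperad K Gen).map _ p)] at this
      exact this
    · have h0 : pr (mapLin K φ p.1) = 0 := by
        refine Subtype.ext ((Finsupp.filter_eq_zero_iff _ _).2 fun t ht => ?_)
        by_contra hne
        obtain ⟨s, hs, rfl⟩ := Finset.mem_image.1
          (Finsupp.mapDomain_support (Finsupp.mem_support_iff.2 hne))
        exact hφ ((p.2 hs).bijective ht)
      rw [h0]
      exact zero_mem _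
  have := key hp
  rw [Submodule.mem_comap, hpr] at this
  exact this

end TreeIdeal

/-! ### Products of combs and the normal form of a tree -/

section Comb

variable {K : Type u} [Field K] {A : Type v} [AddCommGroup A] [Module K A]
  (β : Gen → A →ₗ[K] A →ₗ[K] A)

/-- The product `x m (b₁ m (b₂ m ⋯))`. -/
def mComb : A → List A → A
  | x, [] => x
  | x, y :: b => β .m x (mComb y b)

/-- The product `a₁ ↘ (a₂ ↘ (⋯ ↘ (x m (b₁ m (b₂ m ⋯)))))`. -/
def comb : List A → A → List A → A
  | [], x, b => mComb β x b
  | y :: a, x, b => β .se y (comb a x b)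

/-- The tree `x m (b₁ m (b₂ m ⋯))`. -/
def mCombTree {X : Type} : X → List X → OpTree Gen X
  | x, [] => leaf x
  | x, y :: b => node .m (leaf x) (mCombTree y b)

/-- The tree `a₁ ↘ (a₂ ↘ (⋯ ↘ (x m (b₁ m (b₂ m ⋯)))))`. -/
def treeComb {X : Type} : List X → X → List X → OpTree Gen X
  | [], x, b => mCombTree x b
  | y :: a, x, b => node .se (leaf y) (treeComb a x b)

theorem eval_treeComb {X : Type} (f : X → A) (a : List X) (x : X) (b : List X) :
    (treeComb a x b).eval β f = comb β (a.map f) (f x) (b.map f) := by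
  induction a with
  | nil =>
    simp only [treeComb, comb, List.map_nil]
    induction b generalizing x with
    | nil => rfl
    | cons y b ih => simp only [mCombTree, mComb, List.map_cons, eval, ih]
  | cons y a ih => simp only [treeComb, comb, List.map_cons, eval, ih]

theorem leaves_treeComb {X : Type} (a : List X) (x : X) (b : List X) :
    (treeComb a x b).leaves = a ++ x :: b := by
  induction a with
  | nil =>
    simp only [treeComb, List.nil_append]
    induction b generalizing x with
    | nil => rfl
    | cons y b ih => simp only [mCombTree, leaves, ih, List.singleton_append]
  | cons y a ih => simp only [treeComb, leaves, ih, List.cons_append, List.nil_append]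

theorem treeComb_map {X Y : Type} (f : X → Y) (a : List X) (x : X) (b : List X) :
    (treeComb a x b).map f = treeComb (a.map f) (f x) (b.map f) := by
  induction a with
  | nil =>
    simp only [treeComb, List.map_nil]
    induction b generalizing x with
    | nil => rfl
    | cons y b ih => simp only [mCombTree, List.map_cons, OpTree.map, ih]
  | cons y a ih => simp only [treeComb, List.map_cons, OpTree.map, ih]

variable {β}

theorem map_comb {B : Type w} [AddCommGroup B] [Module K B] {β' : Gen → B →ₗ[K] B →ₗ[K] B}
    (φ : A →ₗ[K] B) (hφ : ∀ ω x y, φ (β ω x y) = β' ω (φ x) (φ y)) (a : List A) (x : A)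
    (b : List A) : φ (comb β a x b) = comb β' (a.map φ) (φ x) (b.map φ) := by
  induction a with
  | nil =>
    simp only [comb, List.map_nil]
    induction b generalizing x with
    | nil => rfl
    | cons y b ih => simp only [mComb, List.map_cons, hφ, ih]
  | cons y a ih => simp only [comb, List.map_cons, hφ, ih]

namespace IsSEDualAlgebra

variable (hβ : IsSEDualAlgebra β)
include hβ

theorem mComb_m (x : A) (b : List A) (x' : A) (b' : List A) :
    β .m (mComb β x b) (mComb β x' b') = mComb β x (b ++ x' :: b') := by
  induction b generalizing x with
  | nil => rfl
  | cons y b ih => simp only [mComb, List.cons_append, hβ.m_assoc, ih]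

/-- The identity `(x ↘ y)z = x ↘ (yz)` carries the right factor past each `↘` down to the `m`-part,
where associativity concatenates. -/
theorem comb_m_nil (a : List A) (x : A) (b : List A) (x' : A) (b' : List A) :
    β .m (comb β a x b) (comb β [] x' b') = comb β a x (b ++ x' :: b') := by
  induction a with
  | nil => exact hβ.mComb_m x b x' b'
  | cons y a ih => exact (hβ.se_m _ _ _).trans (congrArg (β .se y) ih)

theorem m_comb_cons (z y : A) (a : List A) (x : A) (b : List A) :
    β .m z (comb β (y :: a) x b) = 0 := hβ.m_se_zero _ _ _

/-- The identity `(xy) ↘ z = x ↘ (y ↘ z)` turns every `m` of the left factor into `↘`, so all its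
letters join the prefix and its point is lost. -/
theorem comb_nil_se (x : A) (b a' : List A) (x' : A) (b' : List A) :
    β .se (comb β [] x b) (comb β a' x' b') = comb β (x :: b ++ a') x' b' := by
  simp only [comb, List.cons_append]
  induction b generalizing x with
  | nil => rfl
  | cons y b ih => simp only [mComb, List.cons_append, hβ.m_se, ih, comb]

theorem comb_cons_se (y : A) (a : List A) (x : A) (b : List A) (z : A) :
    β .se (comb β (y :: a) x b) z = 0 := hβ.se_se _ _ _

/-- The product of two combs is zero or again a comb. The order of the leaves is tracked because it
determines the labels of the comb. -/
theorem eval_eq_zero_or_comb {X : Type} (f : X → A) (t : OpTree Gen X) :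
    t.eval β f = 0 ∨ ∃ a x b, a ++ x :: b = t.leaves ∧
      t.eval β f = comb β (a.map f) (f x) (b.map f) := by
  induction t with
  | leaf x => exact Or.inr ⟨[], x, [], rfl, rfl⟩
  | node ω s t hs ht =>
    simp only [eval, leaves]
    obtain hs | ⟨a, x, b, hl, hs⟩ := hs
    · left
      rw [hs, map_zero, LinearMap.zero_apply]
    obtain ht | ⟨a', x', b', hl', ht⟩ := ht
    · left
      rw [ht, map_zero]
    rw [hs, ht, ← hl, ← hl']
    cases ω with
    | m =>
      cases a' with
      | nil =>
        refine Or.inr ⟨a, x, b ++ x' :: b', by simp, ?_⟩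
        rw [List.map_nil, hβ.comb_m_nil, List.map_append, List.map_cons]
      | cons y a' => exact Or.inl (hβ.m_comb_cons _ _ _ _ _)
    | se =>
      cases a with
      | nil =>
        refine Or.inr ⟨x :: b ++ a', x', b', by simp, ?_⟩
        rw [List.map_nil, hβ.comb_nil_se, List.map_append, List.map_cons]
      | cons y a => exact Or.inl (hβ.comb_cons_se _ _ _ _ _)

end IsSEDualAlgebra

end Comb

/-! ### Models of the relations on pointed words -/

section PointedWords

variable {K : Type u} [Field K] {A : Type v} [AddCommGroup A] [Module K A]

/-- A spanning family of `A` indexed by words with a pointed letter, with the multiplication rules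
of `T_↘(V)`. -/
structure IsPointedWordFamily {V : Type*} (β : Gen → A →ₗ[K] A →ₗ[K] A)
    (e : List V → V → List V → A) : Prop where
  span_eq_top : Submodule.span K {z | ∃ a x b, z = e a x b} = ⊤
  m_nil : ∀ a x b x' b', β .m (e a x b) (e [] x' b') = e a x (b ++ x' :: b')
  m_cons : ∀ a x b y a' x' b', β .m (e a x b) (e (y :: a') x' b') = 0
  nil_se : ∀ x b a' x' b', β .se (e [] x b) (e a' x' b') = e (x :: b ++ a') x' b'
  cons_se : ∀ y a x b a' x' b', β .se (e (y :: a) x b) (e a' x' b') = 0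

/-- A quadratic relation holds as soon as it holds on a spanning set. -/
theorem quadratic_relation_of_span {β : Gen → A →ₗ[K] A →ₗ[K] A} {S : Set A}
    (hS : Submodule.span K S = ⊤) (c d : K) (ω₁ ω₂ ω₃ ω₄ : Gen)
    (h : ∀ x ∈ S, ∀ y ∈ S, ∀ z ∈ S,
      c • β ω₁ (β ω₂ x y) z = d • β ω₃ x (β ω₄ y z)) (x y z : A) :
    c • β ω₁ (β ω₂ x y) z = d • β ω₃ x (β ω₄ y z) := by
  have hx : x ∈ Submodule.span K S := hS ▸ Submodule.mem_top
  have hy : y ∈ Submodule.span K S := hS ▸ Submodule.mem_top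
  have hz : z ∈ Submodule.span K S := hS ▸ Submodule.mem_top
  induction hx using Submodule.span_induction with
  | zero => simp
  | add x x' _ _ h h' => simp only [map_add, LinearMap.add_apply, smul_add, h, h']
  | smul r x _ h =>
    simp only [map_smul, LinearMap.smul_apply]
    rw [smul_comm c, h, smul_comm d]
  | mem x hx =>
    induction hy using Submodule.span_induction with
    | zero => simp
    | add x x' _ _ h h' => simp only [map_add, LinearMap.add_apply, smul_add, h, h']
    | smul r x _ h =>
      simp only [map_smul, LinearMap.smul_apply]
      rw [smul_comm c, h, smul_comm d]
    | mem y hy =>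
      induction hz using Submodule.span_induction with
      | zero => simp
      | add x x' _ _ h h' => simp only [map_add, smul_add, h, h']
      | smul r x _ h =>
        simp only [map_smul]
        rw [smul_comm c, h, smul_comm d]
      | mem z hz => exact h x hx y hy z hz

namespace IsPointedWordFamily

variable {V : Type*} {β : Gen → A →ₗ[K] A →ₗ[K] A} {e : List V → V → List V → A}
  (he : IsPointedWordFamily β e)
include he

/-- On the spanning family both sides of an identity vanish under the same conditions on which
prefixes are empty; otherwise both are the same concatenation with the same point. -/
theorem isSEDualAlgebra : IsSEDualAlgebra β where
  m_assoc x y z := by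
    have := quadratic_relation_of_span (β := β) he.span_eq_top 1 1 .m .m .m .m (by
      rintro _ ⟨a, x, b, rfl⟩ _ ⟨_ | ⟨c, a'⟩, x', b', rfl⟩ _ ⟨_ | ⟨c', a''⟩, x'', b'', rfl⟩ <;>
        simp [he.m_nil, he.m_cons]) x y z
    simpa using this
  m_se x y z := by
    have := quadratic_relation_of_span (β := β) he.span_eq_top 1 1 .se .m .se .se (by
      rintro _ ⟨_ | ⟨c, a⟩, x, b, rfl⟩ _ ⟨_ | ⟨c', a'⟩, x', b', rfl⟩ _ ⟨a'', x'', b'', rfl⟩ <;>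
        simp [he.m_nil, he.m_cons, he.nil_se, he.cons_se, -List.cons_append]) x y z
    simpa using this
  se_m x y z := by
    have := quadratic_relation_of_span (β := β) he.span_eq_top 1 1 .m .se .se .m (by
      rintro _ ⟨_ | ⟨c, a⟩, x, b, rfl⟩ _ ⟨a', x', b', rfl⟩ _ ⟨_ | ⟨c'', a''⟩, x'', b'', rfl⟩ <;>
        simp [he.m_nil, he.m_cons, he.nil_se, he.cons_se, -List.cons_append]) x y z
    simpa using this
  se_se x y z := by
    -- The coefficient `0` makes the right-hand side vanish, so the operations `.m .m` named there
    -- are placeholders.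
    have := quadratic_relation_of_span (β := β) he.span_eq_top 1 0 .se .se .m .m (by
      rintro _ ⟨_ | ⟨c, a⟩, x, b, rfl⟩ _ ⟨a', x', b', rfl⟩ _ ⟨a'', x'', b'', rfl⟩
      · simp [he.nil_se, he.cons_se]
      · simp [he.cons_se]) x y z
    simpa using this
  m_se_zero x y z := by
    have := quadratic_relation_of_span (β := β) he.span_eq_top 0 1 .m .m .m .se (by
      rintro _ ⟨a, x, b, rfl⟩ _ ⟨_ | ⟨c, a'⟩, x', b', rfl⟩ _ ⟨a'', x'', b'', rfl⟩
      · simp [he.nil_se, he.m_cons]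
      · simp [he.cons_se]) x y z
    simpa using this.symm

/-- The one-letter words generate: a pointed word is built by multiplying one letter at a time from
the left. -/
theorem eq_comb (a : List V) (x : V) (b : List V) :
    e a x b = comb β (a.map fun y => e [] y []) (e [] x []) (b.map fun y => e [] y []) := by
  induction a with
  | nil =>
    simp only [comb, List.map_nil]
    induction b generalizing x with
    | nil => rfl
    | cons y b ih =>
      simp only [mComb, List.map_cons]
      rw [← ih, he.m_nil, List.nil_append]
  | cons y a ih =>
    simp only [comb, List.map_cons]
    rw [← ih, he.nil_se, List.singleton_append]

end IsPointedWordFamily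

variable (K) in
/-- The products of `T_↘` on the vector space with basis the words with a pointed letter. -/
def wordOp (X : Type) : Gen → (List X × X × List X →₀ K) →ₗ[K] (List X × X × List X →₀ K) →ₗ[K]
    (List X × X × List X →₀ K)
  | .m => Finsupp.linearCombination K fun p => Finsupp.linearCombination K fun
    | ([], x, b) => Finsupp.single (p.1, p.2.1, p.2.2 ++ x :: b) 1
    | (_ :: _, _, _) => 0
  | .se => Finsupp.linearCombination K fun
    | ([], x, b) => Finsupp.linearCombination K fun q =>
      Finsupp.single (x :: b ++ q.1, q.2.1, q.2.2) 1
    | (_ :: _, _, _) => 0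

theorem isPointedWordFamily_single (X : Type) :
    IsPointedWordFamily (wordOp K X) fun a x b => Finsupp.single (a, x, b) 1 where
  span_eq_top := by
    rw [← (Finsupp.basisSingleOne (R := K) (ι := List X × X × List X)).span_eq]
    congr 1
    ext z
    simp [eq_comm]
  m_nil a x b x' b' := by simp [wordOp]
  m_cons a x b y a' x' b' := by simp [wordOp]
  nil_se x b a' x' b' := by simp [wordOp]
  cons_se y a x b a' x' b' := by simp [wordOp]

end PointedWords

/-- The coefficients over `k` of a combination with coefficients in the group algebra are those of
its expansion in translates, so a `k`-basis of translates gives both independence and generation. -/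
theorem Representation.exists_basis_asModule {k G V ι : Type*} [Field k] [Group G] [Finite G]
    [Finite ι] [AddCommGroup V] [Module k V] (ρ : Representation k G V) (v : ι → V)
    (b : Module.Basis (ι × G) k V) (hb : ∀ i g, b (i, g) = ρ g (v i)) :
    ∃ b' : Module.Basis ι (MonoidAlgebra k G) ρ.asModule,
      ∀ i, b' i = ρ.asModuleEquiv.symm (v i) := by
  have := Fintype.ofFinite G
  have := Fintype.ofFinite ι
  have hli : LinearIndependent (MonoidAlgebra k G) fun i => ρ.asModuleEquiv.symm (v i) := by
    rw [Fintype.linearIndependent_iff]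
    intro c hc i
    have h := congrArg ρ.asModuleEquiv hc
    simp only [map_sum, Representation.asModuleEquiv_map_smul, LinearEquiv.apply_symm_apply,
      Representation.asAlgebraHom_def, MonoidAlgebra.lift_apply, map_zero] at h
    have h' : ∑ p : ι × G, (c p.1).coeff p.2 • b p = 0 := by
      rw [← h, Fintype.sum_prod_type]
      refine Finset.sum_congr rfl fun i _ => ?_
      rw [Finsupp.sum_fintype _ _ (by simp), LinearMap.sum_apply]
      refine Finset.sum_congr rfl fun g _ => ?_
      rw [hb, LinearMap.smul_apply]
    have := Fintype.linearIndependent_iff.1 b.linearIndependent _ h'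
    ext g
    exact this (i, g)
  have hsp : ⊤ ≤ Submodule.span (MonoidAlgebra k G)
      (Set.range fun i => ρ.asModuleEquiv.symm (v i)) := by
    intro x _
    obtain ⟨y, rfl⟩ := ρ.asModuleEquiv.symm.surjective x
    have hy : y ∈ Submodule.span k (Set.range b) := b.span_eq ▸ Submodule.mem_top
    induction hy using Submodule.span_induction with
    | zero => simp
    | add x y _ _ hx hy =>
      rw [map_add]
      exact add_mem (hx Submodule.mem_top) (hy Submodule.mem_top)
    | smul c x _ hx =>
      rw [Representation.asModuleEquiv_symm_map_smul]
      exact Submodule.smul_mem _ _ (hx Submodule.mem_top)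
    | mem x hx =>
      obtain ⟨⟨i, g⟩, rfl⟩ := hx
      rw [hb, Representation.asModuleEquiv_symm_map_rho]
      exact Submodule.smul_mem _ _ (Submodule.subset_span ⟨i, rfl⟩)
  exact ⟨Module.Basis.mk hli hsp, fun i => Module.Basis.mk_apply hli hsp i⟩

/-- One description singles out the last leaf `z`, the other the pointed leaf `x`; these coincide
exactly when `b` is empty, and the hypothesis reconciles the two. -/
theorem rightComb_eq_treeComb {X : Type} (a c : List X) (z x : X) (b : List X)
    (h : c ++ [z] = x :: b) :
    rightComb (a.map (fun y => (y, Gen.se)) ++ c.map (fun y => (y, Gen.m))) z =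
      treeComb a x b := by
  induction a with
  | nil =>
    simp only [List.map_nil, List.nil_append, treeComb]
    induction c generalizing x b with
    | nil =>
      obtain ⟨rfl, rfl⟩ : z = x ∧ [] = b := by simpa using h
      rfl
    | cons y c ih =>
      obtain ⟨rfl, rfl⟩ : y = x ∧ c ++ [z] = b := by simpa using h
      -- The remaining word is nonempty, so its first letter is the point for the induction
      -- hypothesis.
      obtain ⟨x', b', h'⟩ : ∃ x' b', c ++ [z] = x' :: b' := by cases c <;> simp
      rw [h', mCombTree, ← ih _ _ h']
      rfl
  | cons y a ih =>
    simp only [List.map_cons, List.cons_append, rightComb, treeComb, ih]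

/-- With leaves numbered from zero, the number `i` of vertices `↘` is also the position of the
pointed leaf. -/
theorem combTree_eq_treeComb {n : ℕ} (i : Fin n) :
    combTree i = treeComb ((List.finRange n).take i) i ((List.finRange n).drop (i + 1)) := by
  have hi := i.2
  have h1 : (List.ofFn fun j : Fin (n - 1) =>
      ((⟨j.1, by omega⟩ : Fin n), if j.1 < i.1 then Gen.se else Gen.m)) =
      ((List.finRange n).take i).map (fun y => (y, Gen.se)) ++
        (((List.finRange n).take (n - 1)).drop i).map (fun y => (y, Gen.m)) := by
    refine List.ext_getElem (by simp; omega) fun j h h' => ?_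
    simp only [List.length_ofFn] at h
    by_cases hj : j < i.1
    · rw [List.getElem_append_left (by simp; omega)]
      simp [hj]
    · rw [List.getElem_append_right (by simp; omega)]
      simp only [List.getElem_ofFn, hj, if_false, List.getElem_map, List.getElem_drop,
        List.getElem_take, List.getElem_finRange, List.length_map, List.length_take,
        List.length_finRange]
      congr 1
      ext
      simp
      omega
  rw [combTree, h1]
  refine rightComb_eq_treeComb _ _ _ _ _ ?_
  refine List.ext_getElem (by simp; omega) fun j h h' => ?_
  rcases j with _ | j
  -- If `i = n - 1` there is no vertex `m`, and the pointed leaf is the last leaf, which the list of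
  -- vertices does not contain.
  · by_cases hn : i.1 < n - 1
    · rw [List.getElem_append_left (by simp; omega)]
      simp
    · rw [List.getElem_append_right (by simp; omega)]
      ext
      simp
      omega
  · simp only [List.length_append, List.length_drop, List.length_take, List.length_finRange,
      List.length_singleton] at h
    by_cases hn : i.1 + (j + 1) < n - 1
    · rw [List.getElem_append_left (by simp; omega)]
      ext
      simp
      omega
    · rw [List.getElem_append_right (by simp; omega)]
      ext
      simp
      omega

/-! ### The basis of combs -/

section Basis

variable {K : Type u} [Field K]

theorem seDual_map_tree {X Y : Type} [Finite X] [Finite Y] (e : X ≃ Y) (t : OpTree Gen X)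
    (ht : t.IsLabelled) :
    (seDual K).map e (seDualTree K t ht) = seDualTree K (t.map e) (ht.map_equiv e) :=
  congrArg (Submodule.Quotient.mk (p := (seDualIdeal K).carrier Y)) (map_treeElt e t ht)

theorem seDualTree_congr {X : Type} [Finite X] {s t : OpTree Gen X} (h : s = t)
    (hs : s.IsLabelled) (ht : t.IsLabelled) : seDualTree K s hs = seDualTree K t ht := by
  subst h
  rfl

variable (K) in
/-- Every tree is zero or a comb in `𝓟_↘^!`. -/
theorem seDualTree_eq_zero_or_comb {X : Type} [Finite X] (t : OpTree Gen X) (ht : t.IsLabelled) :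
    seDualTree K t ht = 0 ∨ ∃ a x b, ∃ h : (treeComb a x b).IsLabelled,
      seDualTree K t ht = seDualTree K (treeComb a x b) h := by
  obtain h | ⟨a, x, b, hl, h⟩ := (isSEDualAlgebra_quotOp (K := K) (Z := X)).eval_eq_zero_or_comb
    (fun z => (treeIdeal (seDualIdeal K) X).mkQ (Finsupp.single (leaf z) 1)) t
  · left
    rw [← mkQ_single] at h
    exact (Submodule.Quotient.mk_eq_zero _).2
      (mem_of_mem_treeIdeal (p := treeElt K t ht) ((Submodule.Quotient.mk_eq_zero _).1 h))
  · right
    have hc : (treeComb a x b).IsLabelled := by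
      rw [IsLabelled, leaves_treeComb, hl]
      exact ht
    refine ⟨a, x, b, hc, ?_⟩
    rw [← eval_treeComb, ← mkQ_single, ← mkQ_single] at h
    exact (Submodule.Quotient.eq _).2 (mem_of_mem_treeIdeal
      (p := treeElt K t ht - treeElt K (treeComb a x b) hc) ((Submodule.Quotient.eq _).1 h))

/-- The length of the prefix gives `i`; the word of leaves lists every label once and gives the
permutation. -/
theorem exists_perm_of_treeComb {n : ℕ} {a : List (Fin n)} {x : Fin n} {b : List (Fin n)}
    (h : (treeComb a x b).IsLabelled) :
    ∃ (i : Fin n) (σ : Equiv.Perm (Fin n)), treeComb a x b = (combTree i).map σ := by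
  rw [IsLabelled, leaves_treeComb] at h
  have hl : (a ++ x :: b).length = n := by
    have h' := List.toFinset_card_of_nodup h.1
    rw [Finset.eq_univ_of_forall (s := (a ++ x :: b).toFinset)
      (fun x => List.mem_toFinset.2 (h.2 x))] at h'
    simpa using h'.symm
  have hinj : Function.Injective fun i : Fin n => (a ++ x :: b)[i.1]'(by omega) := fun i j hij =>
    Fin.ext ((h.1.getElem_inj_iff).1 hij)
  let σ := Equiv.ofBijective _ (Finite.injective_iff_bijective.1 hinj)
  have hla : a.length < n := by
    simp only [List.length_append, List.length_cons] at hl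
    omega
  have hσ : (List.finRange n).map σ = a ++ x :: b :=
    List.ext_getElem (by simp [hl]) fun j h h' => by simp [σ]
  refine ⟨⟨a.length, hla⟩, σ, ?_⟩
  rw [combTree_eq_treeComb, treeComb_map, List.map_take, List.map_drop, hσ]
  have hx : σ ⟨a.length, hla⟩ = x := by simp [σ]
  rw [hx]
  simp

variable (K) in
/-- The family of all combs. -/
def combFamily (n : ℕ) (p : Fin n × Equiv.Perm (Fin n)) : (seDual K).obj (Fin n) :=
  seDualTree K ((combTree p.1).map p.2) ((combTree_isLabelled p.1).map_equiv p.2)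

theorem span_combFamily (n : ℕ) : ⊤ ≤ Submodule.span K (Set.range (combFamily K n)) := by
  have key : (Submodule.span K (Set.range (combFamily K n))).mkQ ∘ₗ
      (((seDualIdeal K).carrier (Fin n)).mkQ :
        (freeBinaryOperad K Gen).obj (Fin n) →ₗ[K] (seDual K).obj (Fin n)) = 0 := by
    refine freeBinaryOperad_hom_ext fun t ht => ?_
    refine (Submodule.Quotient.mk_eq_zero _).2 ?_
    change seDualTree K t ht ∈ _
    obtain h | ⟨a, x, b, hc, h⟩ := seDualTree_eq_zero_or_comb K t ht
    · rw [h]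
      exact zero_mem _
    · obtain ⟨i, σ, hi⟩ := exists_perm_of_treeComb hc
      rw [h, seDualTree_congr hi hc ((combTree_isLabelled i).map_equiv σ)]
      exact Submodule.subset_span ⟨(i, σ), rfl⟩
  intro p _
  obtain ⟨p, rfl⟩ := Submodule.Quotient.mk_surjective ((seDualIdeal K).carrier (Fin n)) p
  exact (Submodule.Quotient.mk_eq_zero _).1 (LinearMap.congr_fun key p)

theorem linearIndependent_combFamily (n : ℕ) : LinearIndependent K (combFamily K n) := by
  have hw := isPointedWordFamily_single (K := K) (Fin n)
  -- Evaluation at one-letter words in the algebra of pointed words sends the comb of `(i, σ)` to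
  -- the word `σ 0, …, σ (n - 1)` pointed at position `i`.
  let ev : (seDual K).obj (Fin n) →ₗ[K] (List (Fin n) × Fin n × List (Fin n) →₀ K) :=
    { toFun := fun p => hw.isSEDualAlgebra.algStr.act p fun x => Finsupp.single ([], x, []) 1
      map_add' := fun p q => by rw [map_add]; rfl
      map_smul' := fun c p => by rw [map_smul]; rfl }
  let g : Fin n × Equiv.Perm (Fin n) → List (Fin n) × Fin n × List (Fin n) := fun p =>
    (((List.finRange n).map p.2).take p.1, p.2 p.1, ((List.finRange n).map p.2).drop (p.1 + 1))
  have hev : ev ∘ combFamily K n = (fun q => Finsupp.single q (1 : K)) ∘ g := by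
    ext1 p
    refine (hw.isSEDualAlgebra.algStr_act_tree _ _ _).trans ?_
    rw [combTree_eq_treeComb, treeComb_map, eval_treeComb]
    refine (hw.eq_comb _ _ _).symm.trans ?_
    rw [List.map_take, List.map_drop]
    rfl
  -- A pointed word determines `i` by the length of its prefix, and then `σ` by the whole word.
  have hg : Function.Injective g := by
    rintro ⟨i, σ⟩ ⟨j, τ⟩ h
    simp only [g, Prod.mk.injEq] at h
    obtain ⟨h1, h2, h3⟩ := h
    have hij : i = j := by
      have := congrArg List.length h1
      simp only [List.length_take, List.length_map, List.length_finRange] at this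
      ext
      omega
    subst hij
    have hd : ∀ σ : Equiv.Perm (Fin n), (List.finRange n).map σ =
        ((List.finRange n).map σ).take i ++ σ i :: ((List.finRange n).map σ).drop (i + 1) := by
      intro σ
      have hc : σ i = ((List.finRange n).map σ)[i.1]'(by simp) := by simp
      rw [hc, List.getElem_cons_drop, List.take_append_drop]
    have hst : (List.finRange n).map σ = (List.finRange n).map τ := by
      rw [hd σ, hd τ, h1, h2, h3]
    rw [Prod.mk.injEq]
    refine ⟨rfl, Equiv.ext fun k => ?_⟩
    exact List.map_inj_left.1 hst k (List.mem_finRange k)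
  refine LinearIndependent.of_comp ev ?_
  rw [hev]
  exact (Finsupp.linearIndependent_single_one K _).comp g hg

variable (K) in
/-- The basis of `𝓟_↘^!(n)` given by the combs. -/
def combBasis (n : ℕ) : Module.Basis (Fin n × Equiv.Perm (Fin n)) K ((seDual K).obj (Fin n)) :=
  Module.Basis.mk (linearIndependent_combFamily n) (span_combFamily n)

theorem finrank_seDual (n : ℕ) :
    Module.finrank K ((seDual K).obj (Fin n)) = n * Nat.factorial n := by
  rw [Module.finrank_eq_card_basis (combBasis K n), Fintype.card_prod, Fintype.card_fin,
    Fintype.card_perm, Fintype.card_fin]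

theorem exists_basis_rep (n : ℕ) :
    ∃ b : Module.Basis (Fin n) (MonoidAlgebra K (Equiv.Perm (Fin n)))
        ((seDual K).rep n).asModule,
      ∀ i : Fin n, b i = ((seDual K).rep n).asModuleEquiv.symm
        (seDualTree K (combTree i) (combTree_isLabelled i)) :=
  Representation.exists_basis_asModule _ _ (combBasis K n) fun i σ =>
    (Module.Basis.mk_apply _ _ _).trans (seDual_map_tree σ _ (combTree_isLabelled i)).symm

end Basis

/-! ### The free algebra `T_↘(V)` -/

namespace TSE

variable (K : Type u) [Field K] (V : Type v) [AddCommGroup V] [Module K V]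

/-- The operations `m` and `↘` of `T_↘(V)`. -/
def op : Gen → TSE K V →ₗ[K] TSE K V →ₗ[K] TSE K V
  | .m => mulM K V
  | .se => mulSE K V

variable {V}

/-- The pure tensor `a₁ ⊗ ⋯ ⊗ ẋ ⊗ b₁ ⊗ ⋯` with pointed factor `x`. -/
def pure (a : List V) (x : V) (b : List V) : TSE K V :=
  of K V (a ++ x :: b).length ⟨a.length, by simp⟩ (PiTensorProduct.tprod K (a ++ x :: b).get)

variable {K}

/-- Arities such as `p + q` and the length of a concatenated list agree only propositionally;
comparing entries here replaces all transport between tensor powers. -/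
theorem of_tprod_congr {n n' : ℕ} (h : n = n') {k : Fin n} {k' : Fin n'} (hk : k.1 = k'.1)
    {v : Fin n → V} {v' : Fin n' → V} (hv : ∀ i, v i = v' (Fin.cast h i)) :
    of K V n k (PiTensorProduct.tprod K v) = of K V n' k' (PiTensorProduct.tprod K v') := by
  subst h
  obtain rfl : k = k' := Fin.ext hk
  obtain rfl : v = v' := funext hv
  rfl

theorem of_tprod_eq_pure {n : ℕ} (k : Fin n) (v : Fin n → V) :
    of K V n k (PiTensorProduct.tprod K v) =
      pure K ((List.ofFn v).take k) (v k) ((List.ofFn v).drop (k + 1)) := by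
  have hk := k.2
  have hl : (List.ofFn v).take k ++ v k :: (List.ofFn v).drop (k + 1) = List.ofFn v := by
    have hc : v k = (List.ofFn v)[k.1]'(by simp) := by simp
    rw [hc, List.getElem_cons_drop, List.take_append_drop]
  refine of_tprod_congr (by rw [hl, List.length_ofFn]) (by simp) fun i => ?_
  simp only [List.get_eq_getElem, Fin.val_cast]
  rw [List.getElem_of_eq hl]
  simp

variable (K V) in
theorem span_pure : Submodule.span K {z | ∃ a x b, z = pure K a x (b : List V)} = ⊤ := by
  rw [eq_top_iff]
  rintro z -
  induction z using DirectSum.induction_on with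
  | zero => exact zero_mem _
  | add x y hx hy => exact add_mem hx hy
  | of p t =>
    obtain ⟨n, k⟩ := p
    have ht : t ∈ Submodule.span K (Set.range (PiTensorProduct.tprod K (s := fun _ : Fin n => V))) :=
      PiTensorProduct.span_tprod_eq_top (R := K) (s := fun _ : Fin n => V) ▸ Submodule.mem_top
    change of K V n k t ∈ _
    induction ht using Submodule.span_induction with
    | zero => simp
    | add x y _ _ hx hy =>
      rw [map_add]
      exact add_mem hx hy
    | smul c x _ hx =>
      rw [map_smul]
      exact Submodule.smul_mem _ _ hx
    | mem x hx =>
      obtain ⟨v, rfl⟩ := hx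
      exact Submodule.subset_span ⟨_, _, _, of_tprod_eq_pure k v⟩

theorem concat_tprod {m n : ℕ} (v : Fin m → V) (w : Fin n → V) :
    concat K V m n (PiTensorProduct.tprod K v) (PiTensorProduct.tprod K w) =
      PiTensorProduct.tprod K (Fin.append v w) :=
  TensorPower.tprod_mul_tprod K v w

theorem mulM_of {p q : ℕ} (i : Fin p) (j : Fin q) (s : ⨂[K]^p V) (t : ⨂[K]^q V) :
    mulM K V (of K V p i s) (of K V q j t) =
      if j.1 = 0 then of K V (p + q) (Fin.castAdd q i) (concat K V p q s t) else 0 := by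
  rw [mulM, of, DirectSum.toModule_lof, LinearMap.flip_apply, of, DirectSum.toModule_lof]
  split_ifs <;> rfl

theorem mulSE_of {p q : ℕ} (i : Fin p) (j : Fin q) (s : ⨂[K]^p V) (t : ⨂[K]^q V) :
    mulSE K V (of K V p i s) (of K V q j t) =
      if i.1 = 0 then of K V (p + q) (Fin.natAdd p j) (concat K V p q s t) else 0 := by
  rw [mulSE, of, DirectSum.toModule_lof, LinearMap.flip_apply, of, DirectSum.toModule_lof]
  split_ifs <;> rfl

theorem append_get {α : Type*} {l l' l'' : List α} (h : l ++ l' = l'')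
    (i : Fin (l.length + l'.length)) :
    Fin.append l.get l'.get i = l''.get (Fin.cast (by rw [← h, List.length_append]) i) := by
  subst h
  induction i using Fin.addCases with
  | left i => simp
  | right i => simp

variable (K V) in
-- Spanning and the multiplication rules suffice to make `T_↘(V)` an algebra, so independence of the
-- pure tensors, which fails, is not needed.
theorem isPointedWordFamily_pure : IsPointedWordFamily (op K V) (pure K) where
  span_eq_top := span_pure K V
  m_nil a x b x' b' := by
    rw [op, pure, pure, pure, mulM_of, if_pos List.length_nil, concat_tprod]
    refine of_tprod_congr (by simp; omega) (by rfl) fun i => ?_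
    exact append_get (List.append_assoc a (x :: b) (x' :: b')) i
  m_cons a x b y a' x' b' := by
    rw [op, pure, pure, mulM_of, if_neg (by simp)]
  nil_se x b a' x' b' := by
    rw [op, pure, pure, pure, mulSE_of, if_pos List.length_nil, concat_tprod]
    exact of_tprod_congr (by simp; omega) (by simp; omega) fun i => append_get (by simp) i
  cons_se y a x b a' x' b' := by
    rw [op, pure, pure, mulSE_of, if_neg (by simp)]

theorem incl_eq_pure (x : V) : incl K V x = pure K [] x [] := by
  have h : (PiTensorProduct.subsingletonEquiv (R := K) (s := fun _ : Fin 1 => V) 0).symm x =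
      PiTensorProduct.tprod K fun _ => x := by
    rw [LinearEquiv.symm_apply_eq, PiTensorProduct.subsingletonEquiv_apply_tprod]
  change of K V 1 0 _ = _
  refine (congrArg (of K V 1 0) h).trans (of_tprod_congr rfl rfl fun i => ?_)
  fin_cases i
  rfl

variable (K V) in
/-- The structure of algebra over `𝓟_↘^!` on `T_↘(V)`. -/
def algStr : (seDual K).AlgStr (TSE K V) :=
  (isPointedWordFamily_pure K V).isSEDualAlgebra.algStr

theorem algStr_act_gen (ω : Gen) (x y : TSE K V) :
    (algStr K V).act (seDualGen K ω) ![x, y] = op K V ω x y :=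
  IsSEDualAlgebra.algStr_act_tree _ _ _ _

section Lift

variable {B : Type w} [AddCommGroup B] [Module K B] (𝔟 : (seDual K).AlgStr B) (φ : V →ₗ[K] B)

/-- The morphism from `T_↘(V)` that extends a linear map. -/
def lift : TSE K V →ₗ[K] B :=
  DirectSum.toModule K _ _ fun p => PiTensorProduct.lift
    ((𝔟.act (seDualTree K (combTree p.2) (combTree_isLabelled p.2))).compLinearMap fun _ => φ)

/-- `lift` is defined on each summand by the action of a comb, which makes it well defined on
tensors; this is its value in terms of products in `B`. -/
theorem lift_pure (a : List V) (x : V) (b : List V) :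
    lift 𝔟 φ (pure K a x b) = comb (seDualOp 𝔟) (a.map φ) (φ x) (b.map φ) := by
  rw [lift, pure, of, DirectSum.toModule_lof, PiTensorProduct.lift.tprod,
    MultilinearMap.compLinearMap_apply, seDual_act_tree, combTree_eq_treeComb, eval_treeComb,
    List.map_take, List.map_drop]
  have h : (List.finRange (a ++ x :: b).length).map (fun i => φ ((a ++ x :: b).get i)) =
      a.map φ ++ φ x :: b.map φ := by
    rw [← List.map_cons, ← List.map_append]
    refine List.ext_getElem (by simp) fun i h h' => ?_
    simp only [List.getElem_map, List.getElem_finRange, List.get_eq_getElem, Fin.val_cast]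
  rw [h]
  simp [List.drop_append, List.drop_eq_nil_of_le]

/-- Both sides are bilinear, and on pure tensors the rules of `T_↘(V)` match the rules for combs in
`B`, vanishing cases included. -/
theorem lift_op (ω : Gen) (x y : TSE K V) :
    lift 𝔟 φ (op K V ω x y) = seDualOp 𝔟 ω (lift 𝔟 φ x) (lift 𝔟 φ y) := by
  have he := isPointedWordFamily_pure K V
  have hb := isSEDualAlgebra_seDualOp 𝔟
  have hx : x ∈ Submodule.span K _ := span_pure K V ▸ Submodule.mem_top
  have hy : y ∈ Submodule.span K _ := span_pure K V ▸ Submodule.mem_top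
  induction hx using Submodule.span_induction with
  | zero => simp
  | add x x' _ _ h h' => simp only [map_add, LinearMap.add_apply, h, h']
  | smul c x _ h => simp only [map_smul, LinearMap.smul_apply, h]
  | mem x hx =>
    induction hy using Submodule.span_induction with
    | zero => simp
    | add x x' _ _ h h' => simp only [map_add, h, h']
    | smul c x _ h => simp only [map_smul, h]
    | mem y hy =>
      obtain ⟨a, x, b, rfl⟩ := hx
      obtain ⟨a', x', b', rfl⟩ := hy
      simp only [lift_pure]
      cases ω with
      | m =>
        cases a' with
        | nil =>
          rw [he.m_nil, lift_pure, List.map_nil, hb.comb_m_nil, List.map_append, List.map_cons]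
        | cons y a' => rw [he.m_cons, map_zero, List.map_cons, hb.m_comb_cons]
      | se =>
        cases a with
        | nil =>
          rw [he.nil_se, lift_pure, List.map_nil, hb.comb_nil_se, List.map_append, List.map_cons]
        | cons y a => rw [he.cons_se, map_zero, List.map_cons, hb.comb_cons_se]

/-- Every operation acts through trees in the two generators, so compatibility with `m` and `↘`
suffices. -/
theorem lift_isHom : (algStr K V).IsHom 𝔟 (lift 𝔟 φ) := by
  intro X _ p a
  obtain ⟨p, rfl⟩ := Submodule.Quotient.mk_surjective ((seDualIdeal K).carrier X) p
  refine (hom_evalLin (op K V) (seDualOp 𝔟) (lift 𝔟 φ) (lift_op 𝔟 φ) a p.1).trans ?_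
  exact (seDual_act_mk 𝔟 p _).symm

variable {𝔟}

theorem map_op_of_isHom {f : TSE K V →ₗ[K] B} (hf : (algStr K V).IsHom 𝔟 f) (ω : Gen)
    (x y : TSE K V) : f (op K V ω x y) = seDualOp 𝔟 ω (f x) (f y) := by
  rw [← algStr_act_gen, hf, seDualOp_apply]
  congr 1
  ext i
  fin_cases i <;> rfl

/-- A pure tensor is a comb in elements of `V`, so a morphism is determined on it by its restriction
to `V`. -/
theorem eq_lift_of_isHom {f : TSE K V →ₗ[K] B} (hf : (algStr K V).IsHom 𝔟 f)
    (h : f ∘ₗ incl K V = φ) : f = lift 𝔟 φ := by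
  refine LinearMap.ext_on (span_pure K V) ?_
  rintro _ ⟨a, x, b, rfl⟩
  have hφ : ∀ y : V, f (pure K [] y []) = φ y := fun y => by
    rw [← incl_eq_pure, ← h]
    rfl
  rw [lift_pure, (isPointedWordFamily_pure K V).eq_comb, map_comb f (map_op_of_isHom hf)]
  simp only [List.map_map, Function.comp_def, hφ]

end Lift

variable (K V) in
theorem algStr_isFreeOn : SymmOperad.AlgStr.IsFreeOn.{u, w} (algStr K V) (incl K V) := by
  intro B _ _ 𝔟 φ
  refine ⟨lift 𝔟 φ, ⟨lift_isHom 𝔟 φ, LinearMap.ext fun x => ?_⟩, fun f hf =>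
    eq_lift_of_isHom φ hf.1 hf.2⟩
  rw [LinearMap.comp_apply, incl_eq_pure, lift_pure]
  rfl

end TSE

end

theorem mainTheorem7 (K : Type u) [Field K] :
    (∀ n : ℕ, 1 ≤ n →
      -- the dimension of the arity `n` component
      Module.Finite K ((seDual K).obj (Fin n)) ∧
      Module.finrank K ((seDual K).obj (Fin n)) = n * Nat.factorial n ∧
      -- the arity `n` component is a free `S_n`-module on the `n` combs
      ∃ b : Module.Basis (Fin n) (MonoidAlgebra K (Equiv.Perm (Fin n)))
          ((seDual K).rep n).asModule,
        ∀ i : Fin n, b i = ((seDual K).rep n).asModuleEquiv.symm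
          (seDualTree K (combTree i) (combTree_isLabelled i))) ∧
    -- `T_↘(V)`, with the given products, is the free algebra on `V`
    ∀ (V : Type v) [AddCommGroup V] [Module K V],
      ∃ 𝔞 : (seDual K).AlgStr (TSE K V),
        (∀ x y : TSE K V, 𝔞.act (seDualGen K Gen.m) ![x, y] = TSE.mulM K V x y) ∧
        (∀ x y : TSE K V, 𝔞.act (seDualGen K Gen.se) ![x, y] = TSE.mulSE K V x y) ∧
        SymmOperad.AlgStr.IsFreeOn.{u, w} 𝔞 (TSE.incl K V) := by
  refine ⟨fun n _ => ⟨Module.Finite.of_basis (combBasis K n), finrank_seDual n,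
    exists_basis_rep n⟩, fun V _ _ => ?_⟩
  exact ⟨TSE.algStr K V, TSE.algStr_act_gen .m, TSE.algStr_act_gen .se, TSE.algStr_isFreeOn K V⟩
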